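/- Let $r>0$ and $q=e^{-\pi\sqrt r}$. Let $K(k)=\int_0^{\pi/2}(1-k^2\sin^2\theta)^{-1/2}\,d\theta$ be the complete elliptic integral of the first kind, let $k_r\in(0,1)$ be the singular modulus, i.e. the unique $k\in(0,1)$ with $K(\sqrt{1-k^2})/K(k)=\sqrt r$, and put $K=K(k_r)$, $K'=K(\sqrt{1-k_r^2})$. Let $\mathrm{cd}_1(q,\cdot)$ be the meromorphic function on $\mathbb C$ which on the strip $|\operatorname{Im}u|<K'$ is given by the convergent series $$\mathrm{cd}_1(q,u)=\frac{2\pi}{Kk_r}\sum_{n=0}^{\infty}\frac{(-1)^n q^{n+1/2}\cos\left((2n+3)\frac{\pi u}{2K}\right)}{1-q^{2n+1}} .$$ (The series does have such a meromorphic continuation.) Let $1/\nu$ be a positive integer, let $m$ be an even integer and put $\nu_1=2/\nu$. Then $\mathrm{cd}_1(q,\cdot)$ is analytic at $mK+\nu_1 iK'$ and $$\mathrm{cd}_1\left(q,mK+\nu_1 iK'\right)=(-1)^{m/2}e^{\nu_1\pi\sqrt r}-(-1)^{m/2}\,\frac{2\pi}{Kk_r}\,\sinh\left(\nu_1\pi\sqrt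 r\right)\left(-\sum_{j=0}^{1/\nu-1}\frac{q^{j+1/2}}{1+q^{2j+1}}+\frac{Kk_r}{2\pi}\right).$$ -/

import Mathlib

/-- Complete elliptic integral of the first kind `K(k)`, as a function of the modulus `k`. -/
noncomputable def ellipticK (k : ℝ) : ℝ :=
  ∫ θ in (0 : ℝ)..(Real.pi / 2), 1 / Real.sqrt (1 - k ^ 2 * Real.sin θ ^ 2)

/-- `k` is the singular modulus of `r`: `0 < k < 1` and `K(k') / K(k) = √r`, where
`k' = √(1 - k²)` is the complementary modulus. -/
def IsSingularModulus (r k : ℝ) : Prop :=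
  0 < k ∧ k < 1 ∧ ellipticK (Real.sqrt (1 - k ^ 2)) / ellipticK k = Real.sqrt r

/-- The singular modulus `k_r`. For `r > 0` there is exactly one `k` with
`IsSingularModulus r k`, because `K(k') / K(k)` decreases strictly and continuously from `∞` to
`0` as `k` runs through `(0, 1)`. -/
noncomputable def singularModulus (r : ℝ) : ℝ :=
  Classical.epsilon (IsSingularModulus r)

/-- The quarter period `K = K(k_r)`. -/
noncomputable def quarterK (r : ℝ) : ℝ :=
  ellipticK (singularModulus r)

/-- The complementary quarter period `K' = K(k'_r)`, with `k'_r = √(1 - k_r²)`. -/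
noncomputable def quarterK' (r : ℝ) : ℝ :=
  ellipticK (Real.sqrt (1 - singularModulus r ^ 2))

/-- The nome `q = e^{-π√r}`. -/
noncomputable def nome (r : ℝ) : ℝ :=
  Real.exp (-Real.pi * Real.sqrt r)

/-- The `n`-th term `(-1)ⁿ q^{n+1/2} cos((2n+3) π u / (2K)) / (1 - q^{2n+1})` of the series of
`cd₁`. -/
noncomputable def cdOneTerm (r : ℝ) (u : ℂ) (n : ℕ) : ℂ :=
  (-1 : ℂ) ^ n * ((nome r ^ ((n : ℝ) + 1 / 2) : ℝ) : ℂ)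
    * Complex.cos ((2 * (n : ℂ) + 3) * ((Real.pi : ℂ) / (2 * (quarterK r : ℂ))) * u)
    / (1 - (nome r : ℂ) ^ (2 * n + 1))

/-- `f` is the meromorphic function on `ℂ` given by the series of `cd₁` on the open strip
`|Im u| < K'`, on which this series converges. The normal form fixes the values of `f` (it is
analytic at every removable singularity, and `0` at the poles), so that by the identity theorem
there is at most one such `f`. -/
def IsCdOne (r : ℝ) (f : ℂ → ℂ) : Prop :=
  MeromorphicNFOn f Set.univ ∧
    ∀ u : ℂ, |u.im| < quarterK' r →
      HasSum (fun n : ℕ =>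
        2 * (Real.pi : ℂ) / ((quarterK r : ℂ) * (singularModulus r : ℂ)) * cdOneTerm r u n) (f u)

/-- The function `cd₁(q, ·)` with `q = e^{-π√r}`: the series of `cd₁`, continued
meromorphically to `ℂ`. -/
noncomputable def cdOne (r : ℝ) : ℂ → ℂ :=
  Classical.epsilon (IsCdOne r)

/-! Put `t = √r`, `q = e^{-πt}`. Two things are needed: the continuation of the cosine series, and
the Lambert series `∑ q^{n+1/2}/(1+q^{2n+1}) = K k_r/(2π)`.

The Lambert series comes from `D(z) = ∑_{n∈ℤ} sech π(z - nt)`, a multiple of Jacobi's dn. Write `D'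
= -πS`. Products of such series, summed along diagonals with partial fractions, give `D·S = ∑
sech²·tanh` and express `D·∑ sech²` through `∑ sech³` and `D` (`sechSum_mul_sechTanhSum`,
`sechSum_mul_sechSqSum`). Hence `S² = (a² - D²)(D² - b²)` with `a = D(0)`, `b = D(t/2)`
(`sechSum_ode`). Inverting `D` on `[0, t/2]` gives `K(√(1-(b/a)²)) = πat/2`; inverting it on the
segment from `0` to its pole `i/2` gives `K(b/a) = πa/2`. The quotient is `t`, so `k_r = b/a` and `K
k_r = πb/2`, while `b` is four times the Lambert series (`hasSum_lambert`).

For the continuation, split the cosine into exponentials, expand `1/(1-q^{2n+1})` geometrically and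
sum over `n` first. This gives two copies, at `x = e^{iπu/2K}` and at `1/x`, of `∑_k q^{k+1/2}
x³/(1+q^{2k+1}x²)`, which is meromorphic in `u` (`hasSum_cdHalf`, `meromorphicAt_cdHalf`). At `u =
mK + 2N iK'` one has `x = (-1)^{m/2} q^N`. One copy is then the Lambert series without its first `N`
terms, the other the full series plus the same `N` terms, reflected (`cdHalf_of_exp_eq_pow`,
`cdHalf_of_exp_eq_inv_pow`). The two weights `q^{±2N}` combine into the exponential and the
hyperbolic sine. -/

/-! ### Hyperbolic inequalities and partial fractions. -/

theorem cosh_re_mul_cos_im_le_norm_cosh (w : ℂ) :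
    Real.cosh w.re * Real.cos w.im ≤ ‖Complex.cosh w‖ := by
  have h : (Complex.cosh w).re = Real.cosh w.re * Real.cos w.im := by
    conv_lhs => rw [← Complex.re_add_im w, Complex.cosh_add, Complex.cosh_mul_I, Complex.sinh_mul_I]
    simp [← Complex.ofReal_cosh, ← Complex.ofReal_cos, ← Complex.ofReal_sinh, ← Complex.ofReal_sin]
  rw [← h]
  exact Complex.re_le_norm _

theorem norm_sinh_le_cosh_re (w : ℂ) : ‖Complex.sinh w‖ ≤ Real.cosh w.re := by
  rw [Complex.sinh, Real.cosh_eq, norm_div]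
  have h := norm_sub_le (Complex.exp w) (Complex.exp (-w))
  rw [Complex.norm_exp, Complex.norm_exp, Complex.neg_re] at h
  simpa using div_le_div_of_nonneg_right h (by norm_num : (0:ℝ) ≤ 2)

theorem abs_sinh_re_le_norm_cosh (w : ℂ) : |Real.sinh w.re| ≤ ‖Complex.cosh w‖ := by
  rw [Complex.cosh, Real.sinh_eq, norm_div, abs_div]
  have h := abs_norm_sub_norm_le (Complex.exp w) (-Complex.exp (-w))
  rw [norm_neg, Complex.norm_exp, Complex.norm_exp, Complex.neg_re, sub_neg_eq_add] at h
  simpa using div_le_div_of_nonneg_right h (by norm_num : (0:ℝ) ≤ 2)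

theorem summable_exp_neg_mul_abs_int {c : ℝ} (hc : 0 < c) :
    Summable (fun n : ℤ => Real.exp (-(c * |(n : ℝ)|))) := by
  have h : Summable (fun n : ℕ => Real.exp (-(c * (n : ℝ)))) := by
    have := summable_geometric_of_lt_one (Real.exp_pos (-c)).le (by simpa using hc)
    refine this.congr fun n => ?_
    rw [← Real.exp_nat_mul]
    congr 1
    ring
  refine Summable.of_nat_of_neg ?_ ?_ <;> simpa using h

/-- Partial fractions for fixed `a - b`: after clearing denominators only the addition formulas and
`cosh² - sinh² = 1` are used. On a diagonal of a double series `a - b` is constant, so the right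
side can be summed term by term. -/
theorem sech_mul_sech_sq {a b : ℂ} (ha : Complex.cosh a ≠ 0) (hb : Complex.cosh b ≠ 0)
    (hd : Complex.sinh (a - b) ≠ 0) :
    (Complex.cosh a)⁻¹ * (Complex.cosh b)⁻¹ ^ 2 =
      (Complex.cosh (a - b) / Complex.sinh (a - b) ^ 2) * (Complex.cosh b)⁻¹
        - (1 / Complex.sinh (a - b) ^ 2) * (Complex.cosh a)⁻¹
        - (1 / Complex.sinh (a - b)) * (Complex.sinh b / Complex.cosh b ^ 2) := by
  have h1 := Complex.cosh_sub a b
  have h2 := Complex.sinh_sub a b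
  have ea := Complex.cosh_sq a
  have eb := Complex.cosh_sq b
  field_simp
  rw [h1, h2]
  generalize Complex.cosh a = A at *
  generalize Complex.cosh b = B at *
  generalize Complex.sinh a = X at *
  generalize Complex.sinh b = Y at *
  clear hd h1 h2
  grind

/-- Differentiate `sech a · sech b = (tanh a - tanh b) / sinh (a - b)` with `a - b` held fixed, and
change the sign. -/
theorem sech_mul_deriv_sech_symm {a b : ℂ} (ha : Complex.cosh a ≠ 0) (hb : Complex.cosh b ≠ 0)
    (hd : Complex.sinh (a - b) ≠ 0) :
    (Complex.cosh a)⁻¹ * (Complex.sinh b / Complex.cosh b ^ 2)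
      + (Complex.cosh b)⁻¹ * (Complex.sinh a / Complex.cosh a ^ 2) =
      (1 / Complex.sinh (a - b)) * ((Complex.cosh b)⁻¹ ^ 2 - (Complex.cosh a)⁻¹ ^ 2) := by
  have h2 := Complex.sinh_sub a b
  have ea := Complex.cosh_sq a
  have eb := Complex.cosh_sq b
  field_simp
  rw [h2]
  generalize Complex.cosh a = A at *
  generalize Complex.cosh b = B at *
  generalize Complex.sinh a = X at *
  generalize Complex.sinh b = Y at *
  clear hd h2
  grind

/-! ### Products of bilateral series. -/

/-- The product of two sums over `ℤ`, arranged along the diagonals. -/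
theorem hasSum_mul_diagonals {f g : ℤ → ℂ} (hf : Summable fun n => ‖f n‖)
    (hg : Summable fun n => ‖g n‖) :
    HasSum (fun d : ℤ => ∑' m : ℤ, f (m - d) * g m) ((∑' n, f n) * ∑' n, g n) := by
  have h := summable_mul_of_summable_norm hf hg
  have h2 := tsum_mul_tsum_of_summable_norm hf hg
  let e : ℤ × ℤ ≃ ℤ × ℤ :=
    { toFun := fun p => (p.2 - p.1, p.2)
      invFun := fun p => (p.2 - p.1, p.2)
      left_inv := fun p => by simp
      right_inv := fun p => by simp }
  let F : ℤ × ℤ → ℂ := fun p => f p.1 * g p.2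
  have h3 : HasSum (F ∘ e) ((∑' n, f n) * ∑' n, g n) := by
    rw [h2]
    exact e.hasSum_iff.mpr h.hasSum
  have h4 : ∀ d : ℤ, HasSum (fun m : ℤ => (F ∘ e) (d, m)) (∑' m : ℤ, (F ∘ e) (d, m)) :=
    fun d => (h3.summable.prod_factor d).hasSum
  exact h3.prod_fiberwise h4

theorem summable_shift_mul {f g : ℤ → ℂ} (hf : Summable fun n => ‖f n‖)
    (hg : Summable fun n => ‖g n‖) (d : ℤ) : Summable fun m : ℤ => f (m - d) * g m := by
  have h := summable_mul_of_summable_norm hf hg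
  let i : ℤ → ℤ × ℤ := fun m => (m - d, m)
  have hi : Function.Injective i := fun x y hxy => congrArg Prod.snd hxy
  have := h.comp_injective hi
  exact this

/-- Pairing the diagonals `d` and `-d` lets contributions odd in `d` cancel; every diagonal is then
counted twice. -/
theorem hasSum_mul_diagonals_symm {f g : ℤ → ℂ} (hf : Summable fun n => ‖f n‖)
    (hg : Summable fun n => ‖g n‖) :
    HasSum (fun d : ℤ => (∑' m : ℤ, f (m - d) * g m) + ∑' m : ℤ, f (m - -d) * g m)
      (2 * ((∑' n, f n) * ∑' n, g n)) := by
  have h := hasSum_mul_diagonals hf hg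
  rw [two_mul]
  have h' := (Equiv.neg ℤ).hasSum_iff.mpr h
  exact h.add h'

/-! ### The secant series on the strip: termwise derivatives and bounds. -/

/-- The `n`-th term `sech (π (z - n t))` of the `t`-periodic hyperbolic secant series. -/
noncomputable def sechTerm (t : ℝ) (n : ℤ) (z : ℂ) : ℂ :=
  (Complex.cosh (Real.pi * (z - n * t)))⁻¹

/-- `sech (π (z - n t)) tanh (π (z - n t))`, which is `-1 / π` times the derivative of
`sechTerm`. -/
noncomputable def sechTanhTerm (t : ℝ) (n : ℤ) (z : ℂ) : ℂ :=
  Complex.sinh (Real.pi * (z - n * t)) / Complex.cosh (Real.pi * (z - n * t)) ^ 2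

/-- The open strip `|Im z| < 1 / 2`. -/
def strip : Set ℂ := {z | |z.im| < 1 / 2}

theorem isOpen_strip : IsOpen strip :=
  isOpen_lt (by fun_prop) continuous_const

theorem convex_strip : Convex ℝ strip := by
  have : strip = Complex.imLm ⁻¹' (Set.Ioo (-(1 / 2) : ℝ) (1 / 2)) := by
    ext z
    simp [strip, abs_lt]
  rw [this]
  exact (convex_Ioo _ _).linear_preimage _

theorem im_pi_mul_sub (t : ℝ) (n : ℤ) (z : ℂ) :
    ((Real.pi : ℂ) * (z - n * t)).im = Real.pi * z.im := by
  simp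

theorem re_pi_mul_sub (t : ℝ) (n : ℤ) (z : ℂ) :
    ((Real.pi : ℂ) * (z - n * t)).re = Real.pi * (z.re - n * t) := by
  simp

theorem cos_pi_mul_im_pos {z : ℂ} (hz : z ∈ strip) : 0 < Real.cos (Real.pi * z.im) := by
  have h := abs_lt.mp (show |z.im| < 1 / 2 from hz)
  have hp := Real.pi_pos
  apply Real.cos_pos_of_mem_Ioo
  constructor <;> nlinarith

theorem cosh_ne_zero_of_mem_strip (t : ℝ) (n : ℤ) {z : ℂ} (hz : z ∈ strip) :
    Complex.cosh (Real.pi * (z - n * t)) ≠ 0 := by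
  have h := cosh_re_mul_cos_im_le_norm_cosh ((Real.pi : ℂ) * (z - n * t))
  rw [im_pi_mul_sub] at h
  have h2 := mul_pos (Real.cosh_pos ((Real.pi : ℂ) * (z - n * t)).re) (cos_pi_mul_im_pos hz)
  exact norm_pos_iff.mp (h2.trans_le h)

theorem hasDerivAt_pi_mul_sub (t : ℝ) (n : ℤ) (z : ℂ) :
    HasDerivAt (fun z : ℂ => (Real.pi : ℂ) * (z - n * t)) Real.pi z := by
  simpa using ((hasDerivAt_id z).sub_const ((n : ℂ) * t)).const_mul (Real.pi : ℂ)

theorem hasDerivAt_sechTerm (t : ℝ) (n : ℤ) {z : ℂ} (hz : z ∈ strip) :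
    HasDerivAt (sechTerm t n) (-Real.pi * sechTanhTerm t n z) z := by
  have h := ((hasDerivAt_pi_mul_sub t n z).ccosh).inv (cosh_ne_zero_of_mem_strip t n hz)
  refine h.congr_deriv ?_
  simp only [sechTanhTerm]
  ring

theorem hasDerivAt_sechTanhTerm (t : ℝ) (n : ℤ) {z : ℂ} (hz : z ∈ strip) :
    HasDerivAt (sechTanhTerm t n)
      (Real.pi * (2 * sechTerm t n z ^ 3 - sechTerm t n z)) z := by
  have hc := cosh_ne_zero_of_mem_strip t n hz
  have h := ((hasDerivAt_pi_mul_sub t n z).csinh).div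
    (((hasDerivAt_pi_mul_sub t n z).ccosh).pow 2) (pow_ne_zero 2 hc)
  refine h.congr_deriv ?_
  simp only [sechTerm]
  simp only [Pi.pow_apply]
  generalize (Real.pi : ℂ) * (z - n * t) = w at hc ⊢
  have h2 := Complex.sinh_sq w
  field_simp
  push_cast
  simp only [pow_one]
  linear_combination (-2 * Complex.cosh w) * h2

theorem norm_sechTerm_le (t : ℝ) (n : ℤ) {z : ℂ} (hz : z ∈ strip) :
    ‖sechTerm t n z‖ ≤
      2 / Real.cos (Real.pi * z.im) * Real.exp (-(Real.pi * |z.re - n * t|)) := by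
  have h := cosh_re_mul_cos_im_le_norm_cosh ((Real.pi : ℂ) * (z - n * t))
  rw [im_pi_mul_sub, re_pi_mul_sub, ← Real.cosh_abs, abs_mul, abs_of_pos Real.pi_pos] at h
  have hc := cos_pi_mul_im_pos hz
  have h1 : Real.exp (Real.pi * |z.re - n * t|) / 2 ≤ Real.cosh (Real.pi * |z.re - n * t|) := by
    rw [Real.cosh_eq]
    have := Real.exp_pos (-(Real.pi * |z.re - n * t|))
    linarith
  rw [sechTerm, norm_inv, Real.exp_neg]
  have h2 : Real.exp (Real.pi * |z.re - n * t|) / 2 * Real.cos (Real.pi * z.im) ≤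
      ‖Complex.cosh ((Real.pi : ℂ) * (z - n * t))‖ :=
    (mul_le_mul_of_nonneg_right h1 hc.le).trans h
  refine (inv_anti₀ (by positivity) h2).trans (le_of_eq ?_)
  field_simp

theorem norm_sechTanhTerm_le (t : ℝ) (n : ℤ) {z : ℂ} (hz : z ∈ strip) :
    ‖sechTanhTerm t n z‖ ≤ (1 / Real.cos (Real.pi * z.im)) * ‖sechTerm t n z‖ := by
  have h := cosh_re_mul_cos_im_le_norm_cosh ((Real.pi : ℂ) * (z - n * t))
  rw [im_pi_mul_sub] at h
  have h1 := norm_sinh_le_cosh_re ((Real.pi : ℂ) * (z - n * t))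
  have hc := cos_pi_mul_im_pos hz
  have hn := norm_pos_iff.mpr (cosh_ne_zero_of_mem_strip t n hz)
  rw [sechTerm, sechTanhTerm, norm_inv, norm_div, norm_pow]
  have h3 : ‖Complex.sinh ((Real.pi : ℂ) * (z - n * t))‖ * Real.cos (Real.pi * z.im) ≤
    ‖Complex.cosh ((Real.pi : ℂ) * (z - n * t))‖ := (mul_le_mul_of_nonneg_right h1 hc.le).trans h
  rw [div_mul_eq_mul_div, one_mul, inv_eq_one_div, div_div, div_le_div_iff₀ (by positivity)
    (by positivity)]
  nlinarith

/-- The open box `|Re z| < R`, `|Im z| < η`. -/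
def box (R η : ℝ) : Set ℂ := {z | |z.re| < R ∧ |z.im| < η}

theorem isOpen_box (R η : ℝ) : IsOpen (box R η) :=
  (isOpen_lt (f := fun z : ℂ => |z.re|) (by fun_prop) continuous_const).inter
    (isOpen_lt (f := fun z : ℂ => |z.im|) (by fun_prop) continuous_const)

theorem box_subset_strip {R η : ℝ} (hη : η < 1 / 2) : box R η ⊆ strip :=
  fun _ hz => lt_trans hz.2 hη

theorem exists_box {z : ℂ} (hz : z ∈ strip) : ∃ R η : ℝ, η < 1 / 2 ∧ z ∈ box R η := by
  obtain ⟨η, h1, h2⟩ := exists_between (show |z.im| < 1 / 2 from hz)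
  exact ⟨|z.re| + 1, η, h2, by simp, h1⟩

/-- A family of functions on the strip that is dominated on every box by a multiple of
`exp (-π t |n|)`. -/
def BoxBounded (t : ℝ) (f : ℤ → ℂ → ℂ) : Prop :=
  ∀ R η : ℝ, η < 1 / 2 → ∃ C : ℝ, 0 ≤ C ∧ ∀ n : ℤ, ∀ z ∈ box R η,
    ‖f n z‖ ≤ C * Real.exp (-(Real.pi * t * |(n : ℝ)|))

theorem cos_le_cos_of_mem_box {R η : ℝ} (hη : η < 1 / 2) {z : ℂ} (hz : z ∈ box R η) :
    Real.cos (Real.pi * η) ≤ Real.cos (Real.pi * z.im) := by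
  rw [← Real.cos_abs (Real.pi * z.im), abs_mul, abs_of_pos Real.pi_pos]
  have hp := Real.pi_pos
  have h0 := abs_nonneg z.im
  have h1 := hz.2
  apply Real.cos_le_cos_of_nonneg_of_le_pi <;> nlinarith

theorem cos_pi_mul_pos {R η : ℝ} (hη : η < 1 / 2) {z : ℂ} (hz : z ∈ box R η) :
    0 < Real.cos (Real.pi * η) := by
  have h0 := abs_nonneg z.im
  have h1 := hz.2
  have hp := Real.pi_pos
  apply Real.cos_pos_of_mem_Ioo
  constructor <;> nlinarith

theorem boxBounded_sechTerm {t : ℝ} (ht : 0 < t) : BoxBounded t (sechTerm t) := by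
  intro R η hη
  -- The absolute value secures a nonnegative constant even when the box is empty; as soon as the
  -- box has a point, the cosine is positive.
  refine ⟨|2 / Real.cos (Real.pi * η) * Real.exp (Real.pi * R)|, abs_nonneg _, fun n z hz => ?_⟩
  have hc := cos_pi_mul_pos hη hz
  have hp := Real.pi_pos
  rw [abs_of_pos (by positivity), mul_assoc, ← Real.exp_add]
  refine (norm_sechTerm_le t n (box_subset_strip hη hz)).trans ?_
  have h1 := cos_le_cos_of_mem_box hη hz
  gcongr
  have h2 : |(n : ℝ)| * t ≤ |z.re - n * t| + |z.re| := by
    rw [← abs_of_pos ht, ← abs_mul, abs_of_pos ht]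
    have := abs_sub_abs_le_abs_sub ((n : ℝ) * t) z.re
    rw [abs_sub_comm] at this
    linarith
  have h3 := hz.1
  nlinarith

theorem boxBounded_sechTanhTerm {t : ℝ} (ht : 0 < t) : BoxBounded t (sechTanhTerm t) := by
  intro R η hη
  obtain ⟨C, hC, h⟩ := boxBounded_sechTerm ht R η hη
  refine ⟨|1 / Real.cos (Real.pi * η)| * C, by positivity, fun n z hz => ?_⟩
  have hc := cos_pi_mul_pos hη hz
  rw [abs_of_pos (by positivity), mul_assoc]
  refine (norm_sechTanhTerm_le t n (box_subset_strip hη hz)).trans ?_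
  have h1 := cos_le_cos_of_mem_box hη hz
  have h2 := h n z hz
  gcongr

theorem BoxBounded.mul {t : ℝ} (ht : 0 < t) {f g : ℤ → ℂ → ℂ} (hf : BoxBounded t f)
    (hg : BoxBounded t g) : BoxBounded t (fun n z => f n z * g n z) := by
  intro R η hη
  obtain ⟨C, hC, h⟩ := hf R η hη
  obtain ⟨C', hC', h'⟩ := hg R η hη
  refine ⟨C * C', by positivity, fun n z hz => ?_⟩
  have hp := Real.pi_pos
  have h1 : Real.exp (-(Real.pi * t * |(n : ℝ)|)) ≤ 1 := by
    rw [Real.exp_le_one_iff, neg_nonpos]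
    positivity
  rw [norm_mul]
  calc ‖f n z‖ * ‖g n z‖ ≤ (C * Real.exp (-(Real.pi * t * |(n : ℝ)|))) * (C' * 1) := by
        gcongr
        · exact h n z hz
        · exact (h' n z hz).trans (by gcongr)
    _ = _ := by ring

theorem BoxBounded.summable_norm {t : ℝ} (ht : 0 < t) {f : ℤ → ℂ → ℂ} (hf : BoxBounded t f)
    {z : ℂ} (hz : z ∈ strip) : Summable fun n => ‖f n z‖ := by
  obtain ⟨R, η, hη, hz'⟩ := exists_box hz
  obtain ⟨C, hC, h⟩ := hf R η hη
  exact Summable.of_nonneg_of_le (fun _ => norm_nonneg _) (fun n => h n z hz')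
    ((summable_exp_neg_mul_abs_int (mul_pos Real.pi_pos ht)).mul_left C)

/-- Weierstrass: a series of holomorphic functions with a summable majorant on each box may be
differentiated termwise, so the derivatives need no bound of their own. -/
theorem BoxBounded.hasDerivAt_tsum {t : ℝ} (ht : 0 < t) {f f' : ℤ → ℂ → ℂ} (hf : BoxBounded t f)
    (hd : ∀ n, ∀ z ∈ strip, HasDerivAt (f n) (f' n z) z) {z : ℂ} (hz : z ∈ strip) :
    HasDerivAt (fun z => ∑' n, f n z) (∑' n, f' n z) z := by
  obtain ⟨R, η, hη, hz'⟩ := exists_box hz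
  obtain ⟨C, hC, h⟩ := hf R η hη
  have hs := (summable_exp_neg_mul_abs_int (mul_pos Real.pi_pos ht)).mul_left C
  have hdiff : ∀ n, DifferentiableOn ℂ (f n) (box R η) := fun n w hw =>
    (hd n w (box_subset_strip hη hw)).differentiableAt.differentiableWithinAt
  have h1 := Complex.hasSum_deriv_of_summable_norm hs hdiff (isOpen_box R η) h hz'
  have h2 := (Complex.differentiableOn_tsum_of_summable_norm hs hdiff (isOpen_box R η) h
    ).differentiableAt ((isOpen_box R η).mem_nhds hz')
  have h3 := h2.hasDerivAt
  rw [← h1.tsum_eq] at h3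
  simpa only [(hd _ z hz).deriv] using h3

/-- The `t`-periodic hyperbolic secant series `∑ sech (π (z - n t))`. -/
noncomputable def sechSum (t : ℝ) (z : ℂ) : ℂ := ∑' n : ℤ, sechTerm t n z

/-- The derivative of `sechSum` up to the factor `-π`. -/
noncomputable def sechTanhSum (t : ℝ) (z : ℂ) : ℂ := ∑' n : ℤ, sechTanhTerm t n z

/-- The series `∑ sech² (π (z - n t))`. -/
noncomputable def sechSqSum (t : ℝ) (z : ℂ) : ℂ := ∑' n : ℤ, sechTerm t n z ^ 2

theorem boxBounded_sechTerm_sq {t : ℝ} (ht : 0 < t) :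
    BoxBounded t (fun n z => sechTerm t n z ^ 2) := by
  simpa only [sq] using (boxBounded_sechTerm ht).mul ht (boxBounded_sechTerm ht)

theorem hasDerivAt_sechSum {t : ℝ} (ht : 0 < t) {z : ℂ} (hz : z ∈ strip) :
    HasDerivAt (sechSum t) (-Real.pi * sechTanhSum t z) z := by
  have := (boxBounded_sechTerm ht).hasDerivAt_tsum ht (fun n z hz => hasDerivAt_sechTerm t n hz) hz
  rwa [tsum_mul_left] at this

theorem hasDerivAt_sechSqSum {t : ℝ} (ht : 0 < t) {z : ℂ} (hz : z ∈ strip) :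
    HasDerivAt (sechSqSum t)
      (-2 * Real.pi * ∑' n : ℤ, sechTerm t n z * sechTanhTerm t n z) z := by
  have := (boxBounded_sechTerm_sq ht).hasDerivAt_tsum ht
    (f' := fun n z => -2 * Real.pi * (sechTerm t n z * sechTanhTerm t n z))
    (fun n z hz => by
      refine ((hasDerivAt_sechTerm t n hz).fun_pow 2).congr_deriv ?_
      push_cast
      ring) hz
  rwa [tsum_mul_left] at this

theorem sinh_pi_mul_int_mul_ne_zero {t : ℝ} (ht : 0 < t) {d : ℤ} (hd : d ≠ 0) :
    Complex.sinh (Real.pi * (d * t)) ≠ 0 := by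
  have : ((Real.pi : ℂ) * (d * t)) = ((Real.pi * (d * t) : ℝ) : ℂ) := by push_cast; rfl
  rw [this, ← Complex.ofReal_sinh, Ne, Complex.ofReal_eq_zero, Real.sinh_eq_zero]
  have hp := Real.pi_ne_zero
  have : (d : ℝ) ≠ 0 := by exact_mod_cast hd
  have := ht.ne'
  positivity

theorem tsum_int_shift (f : ℤ → ℂ) (d : ℤ) : ∑' m : ℤ, f (m - d) = ∑' m : ℤ, f m :=
  (Equiv.subRight d).tsum_eq f

theorem summable_int_shift {f : ℤ → ℂ} (hf : Summable f) (d : ℤ) :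
    Summable fun m : ℤ => f (m - d) :=
  (Equiv.subRight d).summable_iff.mpr hf

/-! ### Diagonal sums and the differential equation of dn. -/

/-- The diagonal sums in the product of `sechSum` and `sechSqSum`. -/
theorem tsum_sechTerm_shift_mul_sq {t : ℝ} (ht : 0 < t) {z : ℂ} (hz : z ∈ strip) {d : ℤ}
    (hd : d ≠ 0) :
    ∑' m : ℤ, sechTerm t (m - d) z * sechTerm t m z ^ 2 =
      (Complex.cosh (Real.pi * (d * t)) - 1) / Complex.sinh (Real.pi * (d * t)) ^ 2 * sechSum t z
        - 1 / Complex.sinh (Real.pi * (d * t)) * sechTanhSum t z := by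
  have hs := sinh_pi_mul_int_mul_ne_zero ht hd
  have key : ∀ m : ℤ, sechTerm t (m - d) z * sechTerm t m z ^ 2 =
      Complex.cosh (Real.pi * (d * t)) / Complex.sinh (Real.pi * (d * t)) ^ 2 * sechTerm t m z
      - 1 / Complex.sinh (Real.pi * (d * t)) ^ 2 * sechTerm t (m - d) z
      - 1 / Complex.sinh (Real.pi * (d * t)) * sechTanhTerm t m z := by
    intro m
    have e : (Real.pi : ℂ) * (z - (m - d : ℤ) * t) - Real.pi * (z - m * t) = Real.pi * (d * t) := by
      push_cast
      ring
    have := sech_mul_sech_sq (cosh_ne_zero_of_mem_strip t (m - d) hz)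
      (cosh_ne_zero_of_mem_strip t m hz) (by rwa [e])
    rwa [e] at this
  have s1 : Summable fun m => sechTerm t m z := ((boxBounded_sechTerm ht).summable_norm ht hz).of_norm
  have s2 : Summable fun m => sechTerm t (m - d) z := 
    summable_int_shift (f := fun m => sechTerm t m z) s1 d
  have s3 : Summable fun m => sechTanhTerm t m z :=
    ((boxBounded_sechTanhTerm ht).summable_norm ht hz).of_norm
  simp only [key]
  rw [((s1.mul_left _).sub (s2.mul_left _)).tsum_sub (s3.mul_left _),
    (s1.mul_left _).tsum_sub (s2.mul_left _), tsum_mul_left, tsum_mul_left, tsum_mul_left,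
    tsum_int_shift (fun m => sechTerm t m z) d, sechSum, sechTanhSum]
  ring

/-- Shifting the second sum by `d` turns the two summands into the symmetric combination of
`sech_mul_deriv_sech_symm`. What remains is the sum of a sequence minus the sum of its own shift. -/
theorem tsum_sechTerm_mul_shift_symm {t : ℝ} (ht : 0 < t) {z : ℂ} (hz : z ∈ strip) {d : ℤ}
    (hd : d ≠ 0) :
    (∑' m : ℤ, sechTerm t (m - d) z * sechTanhTerm t m z)
      + ∑' m : ℤ, sechTerm t (m - -d) z * sechTanhTerm t m z = 0 := by
  have hs := sinh_pi_mul_int_mul_ne_zero ht hd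
  have n1 := (boxBounded_sechTerm ht).summable_norm ht hz
  have n2 := (boxBounded_sechTanhTerm ht).summable_norm ht hz
  have s0 : Summable fun m => sechTerm t m z ^ 2 :=
    ((boxBounded_sechTerm_sq ht).summable_norm ht hz).of_norm
  have s0' : Summable fun m => sechTerm t (m - d) z ^ 2 := 
    summable_int_shift (f := fun m => sechTerm t m z ^ 2) s0 d
  have s1 := summable_shift_mul n1 n2 d
  have s2 := summable_shift_mul n1 n2 (-d)
  have s2' : Summable fun m => sechTerm t (m - d - -d) z * sechTanhTerm t (m - d) z :=
    summable_int_shift (f := fun m => sechTerm t (m - -d) z * sechTanhTerm t m z) s2 d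
  rw [← tsum_int_shift (fun m => sechTerm t (m - -d) z * sechTanhTerm t m z) d,
    ← s1.tsum_add s2']
  have key : ∀ m : ℤ, sechTerm t (m - d) z * sechTanhTerm t m z
      + sechTerm t (m - d - -d) z * sechTanhTerm t (m - d) z =
      1 / Complex.sinh (Real.pi * (d * t)) * (sechTerm t m z ^ 2 - sechTerm t (m - d) z ^ 2) := by
    intro m
    have e : (Real.pi : ℂ) * (z - (m - d : ℤ) * t) - Real.pi * (z - m * t) = Real.pi * (d * t) := by
      push_cast
      ring
    have := sech_mul_deriv_sech_symm (cosh_ne_zero_of_mem_strip t (m - d) hz)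
      (cosh_ne_zero_of_mem_strip t m hz) (by rwa [e])
    rw [e] at this
    rw [sub_neg_eq_add, sub_add_cancel]
    exact this
  simp only [key]
  rw [tsum_mul_left, s0.tsum_sub s0', tsum_int_shift (fun m => sechTerm t m z ^ 2) d, sub_self,
    mul_zero]

/-- The constant `∑_{d ≠ 0} (cosh (π d t) - 1) / sinh² (π d t)`. -/
noncomputable def sechConst (t : ℝ) : ℂ :=
  ∑' d : ℤ, (Complex.cosh (Real.pi * (d * t)) - 1) / Complex.sinh (Real.pi * (d * t)) ^ 2

theorem sechSum_mul_sechSqSum {t : ℝ} (ht : 0 < t) {z : ℂ} (hz : z ∈ strip) :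
    sechSum t z * sechSqSum t z = (∑' m : ℤ, sechTerm t m z ^ 3) + sechConst t * sechSum t z := by
  have n1 := (boxBounded_sechTerm ht).summable_norm ht hz
  have n2 := (boxBounded_sechTerm_sq ht).summable_norm ht hz
  have h := hasSum_mul_diagonals_symm n1 n2
  have key : ∀ d : ℤ, (∑' m : ℤ, sechTerm t (m - d) z * sechTerm t m z ^ 2)
      + (∑' m : ℤ, sechTerm t (m - -d) z * sechTerm t m z ^ 2) =
      (if d = 0 then 2 * ∑' m : ℤ, sechTerm t m z ^ 3 else 0) +
      2 * ((Complex.cosh (Real.pi * (d * t)) - 1) / Complex.sinh (Real.pi * (d * t)) ^ 2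
        * sechSum t z) := by
    intro d
    by_cases hd : d = 0
    · subst hd
      have : ∀ m : ℤ, sechTerm t m z * sechTerm t m z ^ 2 = sechTerm t m z ^ 3 := fun m => by ring
      -- At `d = 0` the coefficient reads `0 / 0 = 0`, so `sechConst` skips the main diagonal, which
      -- carries the cubes.
      simp [this]
      ring
    · rw [tsum_sechTerm_shift_mul_sq ht hz hd, tsum_sechTerm_shift_mul_sq ht hz (neg_ne_zero.mpr hd),
        if_neg hd]
      -- Passing from `d` to `-d` changes the sign of `sinh` only, so the two `sechTanhSum`
      -- contributions cancel.
      have : (Real.pi : ℂ) * (((-d : ℤ) : ℂ) * t) = -(Real.pi * (d * t)) := by push_cast; ring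
      rw [this, Complex.cosh_neg, Complex.sinh_neg]
      ring
  simp only [key] at h
  have h0 : HasSum (fun d : ℤ => if d = 0 then 2 * ∑' m : ℤ, sechTerm t m z ^ 3 else 0)
      (2 * ∑' m : ℤ, sechTerm t m z ^ 3) := hasSum_ite_eq 0 _
  have h1 := h.sub h0
  simp only [add_sub_cancel_left] at h1
  have h2 := h1.tsum_eq
  -- In a field constants leave a `tsum` unconditionally, so convergence of the series `sechConst`
  -- need not be shown separately.
  rw [tsum_mul_left, tsum_mul_right] at h2
  rw [sechConst]
  simp only [sechSum, sechSqSum] at h2 ⊢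
  linear_combination -(1 / 2 : ℂ) * h2

theorem sechSum_mul_sechTanhSum {t : ℝ} (ht : 0 < t) {z : ℂ} (hz : z ∈ strip) :
    sechSum t z * sechTanhSum t z = ∑' m : ℤ, sechTerm t m z * sechTanhTerm t m z := by
  have n1 := (boxBounded_sechTerm ht).summable_norm ht hz
  have n2 := (boxBounded_sechTanhTerm ht).summable_norm ht hz
  have h := hasSum_mul_diagonals_symm n1 n2
  have key : ∀ d : ℤ, (∑' m : ℤ, sechTerm t (m - d) z * sechTanhTerm t m z)
      + (∑' m : ℤ, sechTerm t (m - -d) z * sechTanhTerm t m z) =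
      (if d = 0 then 2 * ∑' m : ℤ, sechTerm t m z * sechTanhTerm t m z else 0) := by
    intro d
    by_cases hd : d = 0
    · subst hd
      simp
      ring
    · rw [if_neg hd, tsum_sechTerm_mul_shift_symm ht hz hd]
  simp only [key] at h
  have h0 : HasSum (fun d : ℤ => if d = 0 then 2 * ∑' m : ℤ, sechTerm t m z * sechTanhTerm t m z
      else 0) (2 * ∑' m : ℤ, sechTerm t m z * sechTanhTerm t m z) := hasSum_ite_eq 0 _
  have h1 := h.unique h0
  simp only [sechSum, sechTanhSum]
  linear_combination (1 / 2 : ℂ) * h1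

/-- `sechSum` satisfies the differential equations of `dn`. -/
theorem exists_sechSum_ode {t : ℝ} (ht : 0 < t) : ∃ α β : ℂ, ∀ z ∈ strip,
    HasDerivAt (sechTanhSum t) (-Real.pi * (α * sechSum t z - 2 * sechSum t z ^ 3)) z ∧
      sechTanhSum t z ^ 2 = -sechSum t z ^ 4 + α * sechSum t z ^ 2 + β := by
  have hD := fun (z : ℂ) (hz : z ∈ strip) => hasDerivAt_sechSum ht hz
  have h0 : (0 : ℂ) ∈ strip := by simp [strip]
  have hconst : ∀ f : ℂ → ℂ, (∀ z ∈ strip, HasDerivAt f 0 z) → ∀ z ∈ strip, f z = f 0 := by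
    intro f hf z hz
    exact isOpen_strip.is_const_of_deriv_eq_zero convex_strip.isPreconnected
      (fun w hw => (hf w hw).differentiableAt.differentiableWithinAt)
      (fun w hw => (hf w hw).deriv) hz h0
  -- By `sechSum_mul_sechTanhSum` both `∑ sech²` and `D²` have derivative `-2πDS`. This makes `∑
  -- sech³` a polynomial in `D`, and hence also the derivative of `S`.
  obtain ⟨c, hP⟩ : ∃ c : ℂ, ∀ z ∈ strip, sechSqSum t z = sechSum t z ^ 2 + c := by
    refine ⟨sechSqSum t 0 - sechSum t 0 ^ 2, fun z hz => ?_⟩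
    have := hconst (fun z => sechSqSum t z - sechSum t z ^ 2) (fun w hw => by
      have h := (hasDerivAt_sechSqSum ht hw).sub ((hD w hw).pow 2)
      rw [← sechSum_mul_sechTanhSum ht hw] at h
      refine h.congr_deriv ?_
      push_cast
      ring) z hz
    linear_combination this
  have hd2 : ∀ z ∈ strip, HasDerivAt (sechTanhSum t)
      (-Real.pi * ((1 + 2 * sechConst t - 2 * c) * sechSum t z - 2 * sechSum t z ^ 3)) z := by
    intro z hz
    have h := (boxBounded_sechTanhTerm ht).hasDerivAt_tsum ht
      (fun n z hz => hasDerivAt_sechTanhTerm t n hz) hz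
    have s1 := ((boxBounded_sechTerm ht).summable_norm ht hz).of_norm
    have s3 : Summable fun n : ℤ => sechTerm t n z ^ 3 := by
      have := (((boxBounded_sechTerm_sq ht).mul ht (boxBounded_sechTerm ht)).summable_norm ht
        hz).of_norm
      exact this.congr fun n => by ring
    rw [tsum_mul_left, (s3.mul_left 2).tsum_sub s1, tsum_mul_left] at h
    refine h.congr_deriv ?_
    have h3 := sechSum_mul_sechSqSum ht hz
    rw [hP z hz] at h3
    simp only [sechSum] at h3 ⊢
    linear_combination (-2 * (Real.pi : ℂ)) * h3
  refine ⟨1 + 2 * sechConst t - 2 * c, sechTanhSum t 0 ^ 2 + sechSum t 0 ^ 4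
    - (1 + 2 * sechConst t - 2 * c) * sechSum t 0 ^ 2, fun z hz => ⟨hd2 z hz, ?_⟩⟩
  -- First integral of the second order equation; `β` is its value at `0`.
  have := hconst (fun z => sechTanhSum t z ^ 2 + sechSum t z ^ 4
    - (1 + 2 * sechConst t - 2 * c) * sechSum t z ^ 2) (fun w hw => by
      have h := (((hd2 w hw).pow 2).add ((hD w hw).pow 4)).sub
        (((hD w hw).pow 2).const_mul (1 + 2 * sechConst t - 2 * c))
      refine h.congr_deriv ?_
      push_cast
      ring) z hz
  linear_combination this

/-! ### Symmetries, and values on the two axes. -/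

theorem sechTerm_conj (t : ℝ) (n : ℤ) (z : ℂ) :
    sechTerm t n (starRingEnd ℂ z) = starRingEnd ℂ (sechTerm t n z) := by
  simp [sechTerm, ← Complex.cosh_conj]

theorem sechTanhTerm_conj (t : ℝ) (n : ℤ) (z : ℂ) :
    sechTanhTerm t n (starRingEnd ℂ z) = starRingEnd ℂ (sechTanhTerm t n z) := by
  simp [sechTanhTerm, ← Complex.cosh_conj, ← Complex.sinh_conj]

theorem sechTerm_neg (t : ℝ) (n : ℤ) (z : ℂ) : sechTerm t n (-z) = sechTerm t (-n) z := by
  rw [sechTerm, sechTerm, ← Complex.cosh_neg]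
  congr 2
  push_cast
  ring

theorem sechTanhTerm_neg (t : ℝ) (n : ℤ) (z : ℂ) :
    sechTanhTerm t n (-z) = -sechTanhTerm t (-n) z := by
  have h : (Real.pi : ℂ) * (-z - n * t) = -(Real.pi * (z - (-n : ℤ) * t)) := by
    push_cast
    ring
  rw [sechTanhTerm, sechTanhTerm, h, Complex.cosh_neg, Complex.sinh_neg, neg_div]

theorem sechTanhTerm_add_period (t : ℝ) (n : ℤ) (z : ℂ) :
    sechTanhTerm t n (z + t) = sechTanhTerm t (n - 1) z := by
  have h : (Real.pi : ℂ) * (z + t - n * t) = Real.pi * (z - (n - 1 : ℤ) * t) := by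
    push_cast
    ring
  rw [sechTanhTerm, sechTanhTerm, h]

theorem sechSum_conj (t : ℝ) (z : ℂ) :
    sechSum t (starRingEnd ℂ z) = starRingEnd ℂ (sechSum t z) := by
  simp only [sechSum, sechTerm_conj, Complex.conj_tsum]

theorem sechTanhSum_conj (t : ℝ) (z : ℂ) :
    sechTanhSum t (starRingEnd ℂ z) = starRingEnd ℂ (sechTanhSum t z) := by
  simp only [sechTanhSum, sechTanhTerm_conj, Complex.conj_tsum]

theorem sechSum_neg (t : ℝ) (z : ℂ) : sechSum t (-z) = sechSum t z := by
  simp only [sechSum, sechTerm_neg]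
  exact (Equiv.neg ℤ).tsum_eq (fun n => sechTerm t n z)

theorem sechTanhSum_neg (t : ℝ) (z : ℂ) : sechTanhSum t (-z) = -sechTanhSum t z := by
  simp only [sechTanhSum, sechTanhTerm_neg, tsum_neg]
  exact congrArg Neg.neg ((Equiv.neg ℤ).tsum_eq (fun n => sechTanhTerm t n z))

theorem sechTanhSum_add_period (t : ℝ) (z : ℂ) : sechTanhSum t (z + t) = sechTanhSum t z := by
  simp only [sechTanhSum, sechTanhTerm_add_period]
  exact tsum_int_shift (fun n => sechTanhTerm t n z) 1

theorem sechTanhSum_zero (t : ℝ) : sechTanhSum t 0 = 0 := by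
  have h := sechTanhSum_neg t 0
  rw [neg_zero] at h
  exact self_eq_neg.mp h

/-- An odd function of period `t` vanishes at `t / 2`. -/
theorem sechTanhSum_half_period (t : ℝ) : sechTanhSum t ((t / 2 : ℝ) : ℂ) = 0 := by
  have h := sechTanhSum_neg t ((t / 2 : ℝ) : ℂ)
  rw [← sechTanhSum_add_period] at h
  have e : -((t / 2 : ℝ) : ℂ) + t = ((t / 2 : ℝ) : ℂ) := by
    push_cast
    ring
  rw [e] at h
  exact self_eq_neg.mp h

theorem ofReal_mem_strip (x : ℝ) : (x : ℂ) ∈ strip := by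
  simp [strip]

theorem add_mul_I_mem_strip (x : ℝ) {y : ℝ} (hy : |y| < 1 / 2) :
    (x : ℂ) + y * Complex.I ∈ strip := by
  simpa [strip] using hy

theorem mul_I_mem_strip {y : ℝ} (hy : |y| < 1 / 2) : (y : ℂ) * Complex.I ∈ strip := by
  simpa [strip] using hy

theorem sechSum_ofReal (t x : ℝ) : sechSum t (x : ℂ) = ((sechSum t (x : ℂ)).re : ℂ) := by
  have h := sechSum_conj t (x : ℂ)
  rw [Complex.conj_ofReal] at h
  exact (Complex.conj_eq_iff_re.mp h.symm).symm

theorem sechTanhSum_ofReal (t x : ℝ) :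
    sechTanhSum t (x : ℂ) = ((sechTanhSum t (x : ℂ)).re : ℂ) := by
  have h := sechTanhSum_conj t (x : ℂ)
  rw [Complex.conj_ofReal] at h
  exact (Complex.conj_eq_iff_re.mp h.symm).symm

theorem conj_mul_I (y : ℝ) : starRingEnd ℂ ((y : ℂ) * Complex.I) = -((y : ℂ) * Complex.I) := by
  simp

theorem sechSum_mul_I (t y : ℝ) :
    sechSum t ((y : ℂ) * Complex.I) = ((sechSum t ((y : ℂ) * Complex.I)).re : ℂ) := by
  have h := sechSum_conj t ((y : ℂ) * Complex.I)
  rw [conj_mul_I, sechSum_neg] at h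
  exact (Complex.conj_eq_iff_re.mp h.symm).symm

theorem sechTanhSum_mul_I (t y : ℝ) :
    sechTanhSum t ((y : ℂ) * Complex.I) =
      ((sechTanhSum t ((y : ℂ) * Complex.I)).im : ℂ) * Complex.I := by
  have h := sechTanhSum_conj t ((y : ℂ) * Complex.I)
  rw [conj_mul_I, sechTanhSum_neg] at h
  have h2 := congrArg Complex.re h
  simp only [Complex.neg_re, Complex.conj_re] at h2
  apply Complex.ext <;> simp
  linarith

/-! ### The pole at `i / 2`, and the separation of critical values. -/

theorem sechTerm_re_pos (t : ℝ) (n : ℤ) {z : ℂ} (hz : z ∈ strip) : 0 < (sechTerm t n z).re := by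
  have hne := cosh_ne_zero_of_mem_strip t n hz
  rw [sechTerm, Complex.inv_re]
  refine div_pos ?_ (Complex.normSq_pos.mpr hne)
  have h : ∀ w : ℂ, (Complex.cosh w).re = Real.cosh w.re * Real.cos w.im := by
    intro w
    conv_lhs => rw [← Complex.re_add_im w, Complex.cosh_add, Complex.cosh_mul_I, Complex.sinh_mul_I]
    simp [← Complex.ofReal_cosh, ← Complex.ofReal_cos, ← Complex.ofReal_sinh, ← Complex.ofReal_sin]
  rw [h, im_pi_mul_sub]
  exact mul_pos (Real.cosh_pos _) (cos_pi_mul_im_pos hz)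

theorem sechTerm_zero_re_le {t : ℝ} (ht : 0 < t) {z : ℂ} (hz : z ∈ strip) :
    (sechTerm t 0 z).re ≤ (sechSum t z).re := by
  have hs : Summable fun n => sechTerm t n z := ((boxBounded_sechTerm ht).summable_norm ht hz).of_norm
  rw [sechSum, Complex.re_tsum hs]
  exact (Complex.hasSum_re hs.hasSum).summable.le_tsum 0 fun n _ => (sechTerm_re_pos t n hz).le

theorem sechSum_re_pos {t : ℝ} (ht : 0 < t) {z : ℂ} (hz : z ∈ strip) : 0 < (sechSum t z).re :=
  (sechTerm_re_pos t 0 hz).trans_le (sechTerm_zero_re_le ht hz)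

/-- All terms have positive real part in the strip, so the sum dominates its term `n = 0`; this
yields the blow-up as `y → 1/2`. -/
theorem inv_cos_le_sechSum_mul_I {t : ℝ} (ht : 0 < t) {y : ℝ} (hy : |y| < 1 / 2) :
    (Real.cos (Real.pi * y))⁻¹ ≤ (sechSum t ((y : ℂ) * Complex.I)).re := by
  refine le_trans (le_of_eq ?_) (sechTerm_zero_re_le ht (mul_I_mem_strip hy))
  have : (Real.pi : ℂ) * ((y : ℂ) * Complex.I - (0 : ℤ) * t) = ((Real.pi * y : ℝ) : ℂ) * Complex.I := by
    push_cast
    ring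
  rw [sechTerm, this, Complex.cosh_mul_I, ← Complex.ofReal_cos, ← Complex.ofReal_inv,
    Complex.ofReal_re]

theorem exists_lt_sechSum_mul_I {t : ℝ} (ht : 0 < t) (M : ℝ) :
    ∃ y : ℝ, 0 ≤ y ∧ y < 1 / 2 ∧ M < (sechSum t ((y : ℂ) * Complex.I)).re := by
  have hc : 0 < (|M| + 1)⁻¹ := by positivity
  have hc1 : (|M| + 1)⁻¹ ≤ 1 := inv_le_one_of_one_le₀ (by linarith [abs_nonneg M])
  have hp := Real.pi_pos
  have h1 := Real.arccos_nonneg ((|M| + 1)⁻¹)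
  have h2 := Real.arccos_lt_pi_div_two.mpr hc
  refine ⟨Real.arccos ((|M| + 1)⁻¹) / Real.pi, by positivity, ?_, ?_⟩
  · rw [div_lt_iff₀ hp]
    linarith
  · have hy : |Real.arccos ((|M| + 1)⁻¹) / Real.pi| < 1 / 2 := by
      rw [abs_of_nonneg (by positivity), div_lt_iff₀ hp]
      linarith
    refine lt_of_lt_of_le ?_ (inv_cos_le_sechSum_mul_I ht hy)
    rw [mul_div_cancel₀ _ hp.ne', Real.cos_arccos (by linarith) hc1, inv_inv]
    linarith [le_abs_self M]

/-- The point `x` has distance at least `x` from every `nt`, and `|cosh w| ≥ |sinh (Re w)|`, so each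
term has a bound independent of the imaginary part. -/
theorem exists_norm_sechSum_le {t x : ℝ} (ht : 0 < t) (hx : 0 < x) (hxt : x ≤ t / 2) :
    ∃ M : ℝ, ∀ y : ℝ, |y| < 1 / 2 → ‖sechSum t ((x : ℂ) + y * Complex.I)‖ ≤ M := by
  have hp := Real.pi_pos
  set c : ℝ := 1 - Real.exp (-2 * (Real.pi * x)) with hcdef
  have hc : 0 < c := by
    have : Real.exp (-2 * (Real.pi * x)) < 1 := by
      rw [Real.exp_lt_one_iff]
      have := mul_pos hp hx
      linarith
    linarith
  have hsep : ∀ n : ℤ, x ≤ |x - n * t| := by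
    intro n
    rcases le_or_gt n 0 with h | h
    · have : (n : ℝ) ≤ 0 := by exact_mod_cast h
      have h2 : (n : ℝ) * t ≤ 0 := mul_nonpos_of_nonpos_of_nonneg this ht.le
      exact le_trans (by linarith) (le_abs_self _)
    · have : (1 : ℝ) ≤ n := by exact_mod_cast h
      have h2 : t ≤ (n : ℝ) * t := le_mul_of_one_le_left ht.le this
      exact le_trans (by linarith) (neg_le_abs _)
  have hlow : ∀ v : ℝ, Real.pi * x ≤ v → c / 2 * Real.exp v ≤ Real.sinh v := by
    intro v hv
    have h1 : Real.exp (-v) = Real.exp (-2 * v) * Real.exp v := by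
      rw [← Real.exp_add]
      congr 1
      ring
    have h2 : Real.exp (-2 * v) ≤ Real.exp (-2 * (Real.pi * x)) :=
      Real.exp_le_exp.mpr (by linarith)
    rw [Real.sinh_eq, h1]
    have := Real.exp_pos v
    nlinarith
  have hb : ∀ y : ℝ, |y| < 1 / 2 → ∀ n : ℤ, ‖sechTerm t n ((x : ℂ) + y * Complex.I)‖ ≤
      (2 / c * Real.exp (Real.pi * x)) * Real.exp (-(Real.pi * t * |(n : ℝ)|)) := by
    intro y hy n
    have h := abs_sinh_re_le_norm_cosh ((Real.pi : ℂ) * (((x : ℂ) + y * Complex.I) - n * t))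
    have hre : ((x : ℂ) + y * Complex.I).re = x := by simp
    rw [re_pi_mul_sub, hre] at h
    have h1 := hlow (Real.pi * |x - n * t|) (mul_le_mul_of_nonneg_left (hsep n) hp.le)
    have h2 : |Real.sinh (Real.pi * (x - n * t))| = Real.sinh (Real.pi * |x - n * t|) := by
      rw [Real.abs_sinh, abs_mul, abs_of_pos hp]
    rw [h2] at h
    rw [sechTerm, norm_inv]
    refine (inv_anti₀ (by positivity) (h1.trans h)).trans ?_
    rw [mul_assoc, ← Real.exp_add, mul_inv, inv_div, ← Real.exp_neg]
    gcongr
    have h3 : |(n : ℝ)| * t ≤ |x - n * t| + x := by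
      rw [← abs_of_pos ht, ← abs_mul, abs_of_pos ht]
      have := abs_sub_abs_le_abs_sub ((n : ℝ) * t) x
      rw [abs_sub_comm, abs_of_pos hx] at this
      linarith
    nlinarith
  refine ⟨_, fun y hy => tsum_of_norm_bounded
    ((summable_exp_neg_mul_abs_int (mul_pos hp ht)).mul_left _).hasSum (hb y hy)⟩

/-- On a vertical line `sechSum` is determined by its second order differential equation. -/
theorem sechSum_eq_of_critical {t : ℝ} (ht : 0 < t) {x : ℝ}
    (h0 : sechSum t (x : ℂ) = sechSum t 0) (h1 : sechTanhSum t (x : ℂ) = 0)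
    {Y : ℝ} (hY0 : 0 ≤ Y) (hY : Y < 1 / 2) :
    sechSum t ((x : ℂ) + Y * Complex.I) = sechSum t (Y * Complex.I) := by
  obtain ⟨α, β, hode⟩ := exists_sechSum_ode ht
  have hstrip : ∀ p : ℝ, ∀ y ∈ Set.Icc 0 Y, (p : ℂ) + y * Complex.I ∈ strip := by
    intro p y hy
    apply add_mul_I_mem_strip
    rw [abs_of_nonneg hy.1]
    exact hy.2.trans_lt hY
  have hline : ∀ (p y : ℝ), HasDerivAt (fun y : ℝ => (p : ℂ) + y * Complex.I) Complex.I y := by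
    intro p y
    simpa using ((Complex.ofRealCLM.hasDerivAt (x := y)).mul_const Complex.I).const_add (p : ℂ)
  have hA : ∀ p : ℝ, ∀ y ∈ Set.Icc 0 Y, HasDerivAt (fun y : ℝ => sechSum t ((p : ℂ) + y * Complex.I))
      (-Real.pi * sechTanhSum t ((p : ℂ) + y * Complex.I) * Complex.I) y := fun p y hy =>
    HasDerivAt.comp (h₂ := sechSum t) (h := fun y : ℝ => (p : ℂ) + y * Complex.I) y
      (hasDerivAt_sechSum ht (hstrip p y hy)) (hline p y)
  have hB : ∀ p : ℝ, ∀ y ∈ Set.Icc 0 Y,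
      HasDerivAt (fun y : ℝ => sechTanhSum t ((p : ℂ) + y * Complex.I))
      (-Real.pi * (α * sechSum t ((p : ℂ) + y * Complex.I)
        - 2 * sechSum t ((p : ℂ) + y * Complex.I) ^ 3) * Complex.I) y := fun p y hy =>
    HasDerivAt.comp (h₂ := sechTanhSum t) (h := fun y : ℝ => (p : ℂ) + y * Complex.I) y
      (hode _ (hstrip p y hy)).1 (hline p y)
  set A : ℝ → ℂ := fun y => sechSum t ((x : ℂ) + y * Complex.I) with hAdef
  set B : ℝ → ℂ := fun y => sechSum t (((0 : ℝ) : ℂ) + y * Complex.I) with hBdef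
  have cA : ContinuousOn A (Set.Icc 0 Y) := fun y hy => (hA x y hy).continuousAt.continuousWithinAt
  have cB : ContinuousOn B (Set.Icc 0 Y) := fun y hy => (hA 0 y hy).continuousAt.continuousWithinAt
  -- The factor left after taking `A - B` out of the difference of the cubic right sides. The
  -- differences thus solve a linear system with bounded coefficients and zero initial values, and
  -- Grönwall's inequality applies.
  obtain ⟨C, hC⟩ := isCompact_Icc.exists_bound_of_continuousOn
    (f := fun y => α - 2 * (A y ^ 2 + A y * B y + B y ^ 2)) (s := Set.Icc 0 Y) (by fun_prop)
  let F : ℝ → ℂ × ℂ := fun y => (A y - B y,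
    sechTanhSum t ((x : ℂ) + y * Complex.I) - sechTanhSum t (((0 : ℝ) : ℂ) + y * Complex.I))
  let F' : ℝ → ℂ × ℂ := fun y =>
    (-Real.pi * Complex.I * (F y).2,
      -Real.pi * Complex.I * (α - 2 * (A y ^ 2 + A y * B y + B y ^ 2)) * (F y).1)
  have hF : ∀ y ∈ Set.Icc 0 Y, HasDerivAt F (F' y) y := by
    intro y hy
    refine HasDerivAt.prodMk (((hA x y hy).sub (hA 0 y hy)).congr_deriv ?_)
      (((hB x y hy).sub (hB 0 y hy)).congr_deriv ?_)
    · simp only [F]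
      ring
    · simp only [F, hAdef, hBdef]
      ring
  have hp := Real.pi_pos
  have hzero : ∀ y ∈ Set.Icc 0 Y, F y = 0 := by
    apply eq_zero_of_abs_deriv_le_mul_abs_self_of_eq_zero_right (f' := F')
      (K := Real.pi * max 1 C)
    · exact fun y hy => (hF y hy).continuousAt.continuousWithinAt
    · exact fun y hy => (hF y (Set.Ico_subset_Icc_self hy)).hasDerivWithinAt
    · simp [F, A, B, h0, h1, sechTanhSum_zero]
    · intro y hy
      have hCy := hC y (Set.Ico_subset_Icc_self hy)
      have n1 := norm_fst_le (F y)
      have n2 := norm_snd_le (F y)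
      rw [Prod.norm_def]
      apply max_le
      · simp only [F', norm_mul, norm_neg, Complex.norm_real, Complex.norm_I, Real.norm_eq_abs,
          abs_of_pos hp, one_mul, mul_assoc]
        gcongr
        calc ‖(F y).2‖ = 1 * ‖(F y).2‖ := (one_mul _).symm
          _ ≤ _ := by
            gcongr
            exact le_max_left _ _
      · simp only [F', norm_mul, norm_neg, Complex.norm_real, Complex.norm_I, Real.norm_eq_abs,
          abs_of_pos hp, one_mul, mul_assoc]
        gcongr
        exact hCy.trans (le_max_right _ _)
  have := congrArg Prod.fst (hzero Y ⟨hY0, le_rfl⟩)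
  simp only [F, A, B, Prod.fst_zero, Complex.ofReal_zero, zero_add] at this
  exact sub_eq_zero.mp this

/-- Otherwise `D` would coincide on the vertical segments above `x` and above `0`, yet it is bounded
on the first and unbounded on the second. -/
theorem sechSum_ne_of_critical {t : ℝ} (ht : 0 < t) {x : ℝ} (hx : 0 < x) (hxt : x ≤ t / 2)
    (h1 : sechTanhSum t (x : ℂ) = 0) : sechSum t (x : ℂ) ≠ sechSum t 0 := by
  intro h0
  obtain ⟨M, hM⟩ := exists_norm_sechSum_le ht hx hxt
  obtain ⟨y, hy0, hy, hlt⟩ := exists_lt_sechSum_mul_I ht M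
  have h := hM y (by rwa [abs_of_nonneg hy0])
  rw [sechSum_eq_of_critical ht h0 h1 hy0 hy] at h
  exact absurd (hlt.trans_le (Complex.re_le_norm _)) (not_lt.mpr h)

/-! ### Monotonicity and range on the real and imaginary axes. -/

/-- `sechSum` on the real axis. -/
noncomputable def sechReal (t x : ℝ) : ℝ := (sechSum t (x : ℂ)).re

/-- `sechTanhSum` on the real axis. -/
noncomputable def sechTanhReal (t x : ℝ) : ℝ := (sechTanhSum t (x : ℂ)).re

/-- `sechSum` on the imaginary axis. -/
noncomputable def sechImag (t y : ℝ) : ℝ := (sechSum t (y * Complex.I)).re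

/-- `sechTanhSum` on the imaginary axis, divided by `I`. -/
noncomputable def sechTanhImag (t y : ℝ) : ℝ := (sechTanhSum t (y * Complex.I)).im

theorem sechSum_ofReal_eq (t x : ℝ) : sechSum t (x : ℂ) = (sechReal t x : ℂ) := sechSum_ofReal t x

theorem sechTanhSum_ofReal_eq (t x : ℝ) : sechTanhSum t (x : ℂ) = (sechTanhReal t x : ℂ) :=
  sechTanhSum_ofReal t x

theorem sechSum_mul_I_eq (t y : ℝ) : sechSum t (y * Complex.I) = (sechImag t y : ℂ) :=
  sechSum_mul_I t y

theorem sechTanhSum_mul_I_eq (t y : ℝ) :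
    sechTanhSum t (y * Complex.I) = (sechTanhImag t y : ℂ) * Complex.I :=
  sechTanhSum_mul_I t y

theorem sechReal_pos {t : ℝ} (ht : 0 < t) (x : ℝ) : 0 < sechReal t x :=
  sechSum_re_pos ht (ofReal_mem_strip x)

theorem sechImag_pos {t : ℝ} (ht : 0 < t) {y : ℝ} (hy : |y| < 1 / 2) : 0 < sechImag t y :=
  sechSum_re_pos ht (mul_I_mem_strip hy)

theorem sechImag_zero (t : ℝ) : sechImag t 0 = sechReal t 0 := by
  simp [sechImag, sechReal]

theorem hasDerivAt_sechReal {t : ℝ} (ht : 0 < t) (x : ℝ) :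
    HasDerivAt (sechReal t) (-Real.pi * sechTanhReal t x) x := by
  have h := (hasDerivAt_sechSum ht (ofReal_mem_strip x)).real_of_complex
  refine h.congr_deriv ?_
  rw [sechTanhSum_ofReal_eq]
  norm_cast

theorem hasDerivAt_mul_I (y : ℝ) : HasDerivAt (fun y : ℝ => (y : ℂ) * Complex.I) Complex.I y := by
  simpa using (Complex.ofRealCLM.hasDerivAt (x := y)).mul_const Complex.I

theorem hasDerivAt_sechImag {t : ℝ} (ht : 0 < t) {y : ℝ} (hy : |y| < 1 / 2) :
    HasDerivAt (sechImag t) (Real.pi * sechTanhImag t y) y := by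
  have h : HasDerivAt (fun y : ℝ => sechSum t (y * Complex.I)) _ y :=
    HasDerivAt.comp (h₂ := sechSum t) (h := fun y : ℝ => (y : ℂ) * Complex.I) y
      (hasDerivAt_sechSum ht (mul_I_mem_strip hy)) (hasDerivAt_mul_I y)
  have h2 : HasDerivAt (sechImag t) _ y := Complex.reCLM.hasFDerivAt.comp_hasDerivAt y h
  refine h2.congr_deriv ?_
  rw [sechTanhSum_mul_I_eq]
  simp

/-- The differential equation of `sechSum` in factored form. -/
theorem sechSum_ode {t : ℝ} (ht : 0 < t) :
    sechReal t 0 ≠ sechReal t (t / 2) ∧ ∀ z ∈ strip,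
    HasDerivAt (sechTanhSum t) (-Real.pi * (((sechReal t 0 : ℂ) ^ 2 + (sechReal t (t / 2) : ℂ) ^ 2)
      * sechSum t z - 2 * sechSum t z ^ 3)) z ∧
      sechTanhSum t z ^ 2 = ((sechReal t 0 : ℂ) ^ 2 - sechSum t z ^ 2)
        * (sechSum t z ^ 2 - (sechReal t (t / 2) : ℂ) ^ 2) := by
  obtain ⟨α, β, h⟩ := exists_sechSum_ode ht
  have hne : sechReal t 0 ≠ sechReal t (t / 2) := by
    intro he
    apply sechSum_ne_of_critical ht (half_pos ht) le_rfl (sechTanhSum_half_period t)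
    have h0 := sechSum_ofReal_eq t 0
    rw [Complex.ofReal_zero] at h0
    rw [sechSum_ofReal_eq, h0, he]
  have ha := sechReal_pos ht 0
  have hb := sechReal_pos ht (t / 2)
  have h0 := (h ((0 : ℝ) : ℂ) (ofReal_mem_strip 0)).2
  have h1 := (h ((t / 2 : ℝ) : ℂ) (ofReal_mem_strip _)).2
  rw [sechTanhSum_half_period, sechSum_ofReal_eq] at h1
  rw [sechSum_ofReal_eq, Complex.ofReal_zero, sechTanhSum_zero] at h0
  -- `a²` and `b²` are roots of `-X² + αX + β`; being distinct, they determine `α` and `β`.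
  have hsq : (sechReal t 0 : ℂ) ^ 2 - (sechReal t (t / 2) : ℂ) ^ 2 ≠ 0 := by
    intro hh
    apply hne
    have : sechReal t 0 ^ 2 - sechReal t (t / 2) ^ 2 = 0 := by exact_mod_cast hh
    nlinarith
  have hα : α = (sechReal t 0 : ℂ) ^ 2 + (sechReal t (t / 2) : ℂ) ^ 2 := by
    apply mul_left_cancel₀ hsq
    linear_combination h1 - h0
  refine ⟨hne, fun z hz => ⟨?_, ?_⟩⟩
  · rw [← hα]
    exact (h z hz).1
  · rw [(h z hz).2]
    rw [hα] at h0 ⊢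
    linear_combination -h0

theorem sechTanhReal_sq {t : ℝ} (ht : 0 < t) (x : ℝ) :
    sechTanhReal t x ^ 2 =
      (sechReal t 0 ^ 2 - sechReal t x ^ 2) * (sechReal t x ^ 2 - sechReal t (t / 2) ^ 2) := by
  have h := ((sechSum_ode ht).2 (x : ℂ) (ofReal_mem_strip x)).2
  rw [sechSum_ofReal_eq, sechTanhSum_ofReal_eq] at h
  exact_mod_cast h

theorem sechTanhImag_sq {t : ℝ} (ht : 0 < t) {y : ℝ} (hy : |y| < 1 / 2) :
    sechTanhImag t y ^ 2 =
      (sechImag t y ^ 2 - sechReal t 0 ^ 2) * (sechImag t y ^ 2 - sechReal t (t / 2) ^ 2) := by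
  have h := ((sechSum_ode ht).2 _ (mul_I_mem_strip hy)).2
  rw [sechSum_mul_I_eq, sechTanhSum_mul_I_eq, mul_pow, Complex.I_sq] at h
  have h2 : -sechTanhImag t y ^ 2 =
      (sechReal t 0 ^ 2 - sechImag t y ^ 2) * (sechImag t y ^ 2 - sechReal t (t / 2) ^ 2) := by
    have : (sechTanhImag t y : ℂ) ^ 2 * -1 = -(sechTanhImag t y : ℂ) ^ 2 := by ring
    rw [this] at h
    exact_mod_cast h
  linarith

theorem hasDerivAt_sechTanhReal {t : ℝ} (ht : 0 < t) (x : ℝ) :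
    HasDerivAt (sechTanhReal t) (-Real.pi * ((sechReal t 0 ^ 2 + sechReal t (t / 2) ^ 2)
      * sechReal t x - 2 * sechReal t x ^ 3)) x := by
  have h := ((sechSum_ode ht).2 (x : ℂ) (ofReal_mem_strip x)).1.real_of_complex
  refine h.congr_deriv ?_
  rw [sechSum_ofReal_eq]
  norm_cast

theorem hasDerivAt_sechTanhImag {t : ℝ} (ht : 0 < t) {y : ℝ} (hy : |y| < 1 / 2) :
    HasDerivAt (sechTanhImag t) (-Real.pi * ((sechReal t 0 ^ 2 + sechReal t (t / 2) ^ 2)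
      * sechImag t y - 2 * sechImag t y ^ 3)) y := by
  have h : HasDerivAt (fun y : ℝ => sechTanhSum t (y * Complex.I)) _ y :=
    HasDerivAt.comp (h₂ := sechTanhSum t) (h := fun y : ℝ => (y : ℂ) * Complex.I) y
      ((sechSum_ode ht).2 _ (mul_I_mem_strip hy)).1 (hasDerivAt_mul_I y)
  have h2 : HasDerivAt (sechTanhImag t) _ y := Complex.imCLM.hasFDerivAt.comp_hasDerivAt y h
  refine h2.congr_deriv ?_
  rw [sechSum_mul_I_eq]
  rw [Complex.imCLM_apply, Complex.mul_I_im]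
  norm_cast

theorem continuousOn_sechImag {t : ℝ} (ht : 0 < t) {y : ℝ} (hy : y < 1 / 2) :
    ContinuousOn (sechImag t) (Set.Icc 0 y) := fun u hu =>
  (hasDerivAt_sechImag ht (by rw [abs_of_nonneg hu.1]; exact hu.2.trans_lt hy)
    ).continuousAt.continuousWithinAt

/-- If `a < b`, then `D(iy)`, rising from `a` to beyond `b`, would take a value strictly between,
where the first integral makes a real square negative. -/
theorem sechReal_half_lt {t : ℝ} (ht : 0 < t) : sechReal t (t / 2) < sechReal t 0 := by
  rcases (sechSum_ode ht).1.lt_or_gt with h | h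
  · exfalso
    obtain ⟨y, hy0, hy, hlt⟩ := exists_lt_sechSum_mul_I ht (sechReal t (t / 2))
    obtain ⟨c, h1, h2⟩ := exists_between h
    obtain ⟨u, hu, rfl⟩ := intermediate_value_Icc hy0 (continuousOn_sechImag ht hy)
      (show c ∈ Set.Icc _ _ from ⟨by rw [sechImag_zero]; exact h1.le, (h2.trans hlt).le⟩)
    have hu' : |u| < 1 / 2 := by rw [abs_of_nonneg hu.1]; exact hu.2.trans_lt hy
    have hsq := sechTanhImag_sq ht hu'
    have ha := sechReal_pos ht 0
    have e1 : 0 < sechImag t u ^ 2 - sechReal t 0 ^ 2 := by nlinarith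
    have e2 : 0 < sechReal t (t / 2) ^ 2 - sechImag t u ^ 2 := by nlinarith
    nlinarith [sq_nonneg (sechTanhImag t u), mul_pos e1 e2]
  · exact h

theorem sechReal_zero_le_sechImag {t : ℝ} (ht : 0 < t) {y : ℝ} (hy0 : 0 ≤ y) (hy : y < 1 / 2) :
    sechReal t 0 ≤ sechImag t y := by
  by_contra! hlt
  have hab := sechReal_half_lt ht
  have hb := sechReal_pos ht (t / 2)
  obtain ⟨c, h1, h2⟩ := exists_between (max_lt hlt hab)
  obtain ⟨h1, h3⟩ := max_lt_iff.mp h1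
  obtain ⟨u, hu, rfl⟩ := intermediate_value_Icc' hy0 (continuousOn_sechImag ht hy)
    (show c ∈ Set.Icc _ _ from ⟨h1.le, by rw [sechImag_zero]; exact h2.le⟩)
  have hu' : |u| < 1 / 2 := by rw [abs_of_nonneg hu.1]; exact hu.2.trans_lt hy
  have hsq := sechTanhImag_sq ht hu'
  have e1 : 0 < sechReal t 0 ^ 2 - sechImag t u ^ 2 := by nlinarith
  have e2 : 0 < sechImag t u ^ 2 - sechReal t (t / 2) ^ 2 := by nlinarith
  nlinarith [sq_nonneg (sechTanhImag t u), mul_pos e1 e2]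

/-- It starts at `0` with derivative `πE(2E² - a² - b²)`, where `E = D(iy)`, and this is positive
because `E ≥ a > b`. -/
theorem sechTanhImag_pos {t : ℝ} (ht : 0 < t) {y : ℝ} (hy0 : 0 < y) (hy : y < 1 / 2) :
    0 < sechTanhImag t y := by
  have habs : ∀ u ∈ Set.Icc 0 y, |u| < 1 / 2 := fun u hu => by
    rw [abs_of_nonneg hu.1]
    exact hu.2.trans_lt hy
  have h := strictMonoOn_of_deriv_pos (convex_Icc 0 y) (f := sechTanhImag t)
    (fun u hu => (hasDerivAt_sechTanhImag ht (habs u hu)).continuousAt.continuousWithinAt)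
    (fun u hu => by
      rw [interior_Icc] at hu
      rw [(hasDerivAt_sechTanhImag ht (habs u (Set.Ioo_subset_Icc_self hu))).deriv]
      have h1 := sechReal_zero_le_sechImag ht hu.1.le (hu.2.trans hy)
      have hab := sechReal_half_lt ht
      have hb := sechReal_pos ht (t / 2)
      have e1 : sechReal t (t / 2) ^ 2 < sechReal t 0 ^ 2 := by nlinarith
      have e2 : sechReal t 0 ^ 2 ≤ sechImag t u ^ 2 := by nlinarith
      have e3 := mul_pos (mul_pos Real.pi_pos (hb.trans (hab.trans_le h1)))
        (show 0 < 2 * sechImag t u ^ 2 - sechReal t 0 ^ 2 - sechReal t (t / 2) ^ 2 by linarith)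
      linarith)
  have h0 := h ⟨le_rfl, hy0.le⟩ ⟨hy0.le, le_rfl⟩ hy0
  have : sechTanhImag t 0 = 0 := by simp [sechTanhImag, sechTanhSum_zero]
  rwa [this] at h0

theorem sechReal_zero_lt_sechImag {t : ℝ} (ht : 0 < t) {y : ℝ} (hy0 : 0 < y) (hy : y < 1 / 2) :
    sechReal t 0 < sechImag t y := by
  refine lt_of_le_of_ne (sechReal_zero_le_sechImag ht hy0.le hy) fun h => ?_
  have h1 := sechTanhImag_pos ht hy0 hy
  have h2 := sechTanhImag_sq ht (show |y| < 1 / 2 by rwa [abs_of_pos hy0])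
  rw [← h, sub_self, zero_mul] at h2
  nlinarith

theorem sechReal_mem_Icc {t : ℝ} (ht : 0 < t) (x : ℝ) :
    sechReal t x ∈ Set.Icc (sechReal t (t / 2)) (sechReal t 0) := by
  have hab := sechReal_half_lt ht
  have hb := sechReal_pos ht (t / 2)
  have hx := sechReal_pos ht x
  have hsq := sechTanhReal_sq ht x
  have h0 := sq_nonneg (sechTanhReal t x)
  rw [hsq] at h0
  constructor
  · by_contra! h
    have e1 : 0 < sechReal t 0 ^ 2 - sechReal t x ^ 2 := by nlinarith
    have e2 : 0 < sechReal t (t / 2) ^ 2 - sechReal t x ^ 2 := by nlinarith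
    nlinarith [mul_pos e1 e2]
  · by_contra! h
    have e1 : 0 < sechReal t x ^ 2 - sechReal t 0 ^ 2 := by nlinarith
    have e2 : 0 < sechReal t x ^ 2 - sechReal t (t / 2) ^ 2 := by nlinarith
    nlinarith [mul_pos e1 e2]

theorem sechReal_eq_half_of_critical {t : ℝ} (ht : 0 < t) {x : ℝ} (hx : 0 < x) (hxt : x ≤ t / 2)
    (h : sechTanhReal t x = 0) : sechReal t x = sechReal t (t / 2) := by
  have hne := sechSum_ne_of_critical ht hx hxt (by rw [sechTanhSum_ofReal_eq, h, Complex.ofReal_zero])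
  have h0 := sechSum_ofReal_eq t 0
  rw [Complex.ofReal_zero] at h0
  rw [sechSum_ofReal_eq, h0, Ne, Complex.ofReal_inj] at hne
  have hsq := sechTanhReal_sq ht x
  have ha := sechReal_pos ht 0
  have hb := sechReal_pos ht (t / 2)
  have hx' := sechReal_pos ht x
  rw [h, zero_pow two_ne_zero, eq_comm, mul_eq_zero] at hsq
  rcases hsq with h1 | h1
  · exact absurd (by nlinarith) hne
  · nlinarith

/-- At an interior critical point `D` takes its least value `b`. The maximum of `D` on `[x, t/2]` is
at an endpoint or critical, hence also `b`, so `D` is constant there. This contradicts the second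
order equation, since `b(a² - b²) ≠ 0`. -/
theorem sechTanhReal_ne_zero {t : ℝ} (ht : 0 < t) {x : ℝ} (hx : x ∈ Set.Ioo 0 (t / 2)) :
    sechTanhReal t x ≠ 0 := by
  intro h
  have hab := sechReal_half_lt ht
  have hb := sechReal_pos ht (t / 2)
  have hp := Real.pi_pos
  have hcont : Continuous (sechReal t) :=
    continuous_iff_continuousAt.mpr fun u => (hasDerivAt_sechReal ht u).continuousAt
  obtain ⟨m, hm, hmax⟩ := isCompact_Icc.exists_isMaxOn (Set.nonempty_Icc.mpr hx.2.le)
    hcont.continuousOn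
  have hxb := sechReal_eq_half_of_critical ht hx.1 hx.2.le h
  have hmb : sechReal t m = sechReal t (t / 2) := by
    rcases eq_or_lt_of_le hm.1 with h1 | h1
    · rw [← h1, hxb]
    rcases eq_or_lt_of_le hm.2 with h2 | h2
    · rw [h2]
    have hd := (hmax.isLocalMax (Icc_mem_nhds h1 h2)).hasDerivAt_eq_zero (hasDerivAt_sechReal ht m)
    refine sechReal_eq_half_of_critical ht (hx.1.trans h1) h2.le ?_
    simpa [hp.ne'] using hd
  have hconst : ∀ u ∈ Set.Icc x (t / 2), sechReal t u = sechReal t (t / 2) := fun u hu =>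
    le_antisymm ((hmax hu).trans hmb.le) (sechReal_mem_Icc ht u).1
  have hzero : ∀ u ∈ Set.Icc x (t / 2), sechTanhReal t u = 0 := fun u hu => by
    have := sechTanhReal_sq ht u
    rw [hconst u hu, sub_self, mul_zero] at this
    exact pow_eq_zero_iff two_ne_zero |>.mp this
  have hmid : (x + t / 2) / 2 ∈ Set.Ioo x (t / 2) := by
    have := hx.2
    constructor <;> linarith
  have hev : sechTanhReal t =ᶠ[nhds ((x + t / 2) / 2)] fun _ => (0 : ℝ) :=
    Filter.eventually_of_mem (Icc_mem_nhds hmid.1 hmid.2) hzero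
  have hd := ((hasDerivAt_const _ (0 : ℝ)).congr_of_eventuallyEq hev).unique
    (hasDerivAt_sechTanhReal ht ((x + t / 2) / 2))
  rw [hconst _ (Set.Ioo_subset_Icc_self hmid)] at hd
  have e1 : 0 < sechReal t 0 ^ 2 - sechReal t (t / 2) ^ 2 := by nlinarith
  have := mul_pos (mul_pos hp hb) e1
  nlinarith

/-- The mean value theorem and `b < a` give one point where it is positive; having no zero, it keeps
its sign. -/
theorem sechTanhReal_pos {t : ℝ} (ht : 0 < t) {x : ℝ} (hx : x ∈ Set.Ioo 0 (t / 2)) :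
    0 < sechTanhReal t x := by
  have hp := Real.pi_pos
  obtain ⟨c, hc, hcd⟩ := exists_hasDerivAt_eq_slope (sechReal t)
    (fun u => -Real.pi * sechTanhReal t u) (half_pos ht)
    (fun u _ => (hasDerivAt_sechReal ht u).continuousAt.continuousWithinAt)
    (fun u _ => hasDerivAt_sechReal ht u)
  have hab := sechReal_half_lt ht
  have hcpos : 0 < sechTanhReal t c := by
    have : (sechReal t (t / 2) - sechReal t 0) / (t / 2 - 0) < 0 :=
      div_neg_of_neg_of_pos (by linarith) (by linarith)
    rw [← hcd] at this
    by_contra! h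
    nlinarith
  by_contra! h
  have hcont : ContinuousOn (sechTanhReal t) (Set.Ioo 0 (t / 2)) := fun u _ =>
    (hasDerivAt_sechTanhReal ht u).continuousAt.continuousWithinAt
  obtain ⟨u, hu, hu0⟩ := isPreconnected_Ioo.intermediate_value hx hc hcont ⟨h, hcpos.le⟩
  exact sechTanhReal_ne_zero ht hu hu0

theorem sechReal_mem_Ioo {t : ℝ} (ht : 0 < t) {x : ℝ} (hx : x ∈ Set.Ioo 0 (t / 2)) :
    sechReal t x ∈ Set.Ioo (sechReal t (t / 2)) (sechReal t 0) := by
  have h := sechReal_mem_Icc ht x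
  have hs := sechTanhReal_sq ht x
  have hpos := pow_pos (sechTanhReal_pos ht hx) 2
  constructor
  · refine lt_of_le_of_ne h.1 fun he => ?_
    rw [← he, sub_self, mul_zero] at hs
    exact hpos.ne' hs
  · refine lt_of_le_of_ne h.2 fun he => ?_
    rw [he, sub_self, zero_mul] at hs
    exact hpos.ne' hs

/-! ### Complete elliptic integrals from the secant series. -/

theorem one_sub_sq_mul_sin_sq_pos {k : ℝ} (hk0 : 0 ≤ k) (hk : k < 1) (θ : ℝ) :
    0 < 1 - k ^ 2 * Real.sin θ ^ 2 := by
  have h1 := Real.sin_sq_le_one θ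
  have h2 : k ^ 2 < 1 := by nlinarith
  nlinarith [sq_nonneg k, sq_nonneg (Real.sin θ)]

theorem continuous_elliptic_integrand {k : ℝ} (hk0 : 0 ≤ k) (hk : k < 1) :
    Continuous fun θ : ℝ => 1 / Real.sqrt (1 - k ^ 2 * Real.sin θ ^ 2) :=
  continuous_const.div (by fun_prop) fun θ =>
    (Real.sqrt_pos.mpr (one_sub_sq_mul_sin_sq_pos hk0 hk θ)).ne'

/-- The incomplete elliptic integral of the first kind. -/
noncomputable def ellipticF (k φ : ℝ) : ℝ :=
  ∫ θ in (0 : ℝ)..φ, 1 / Real.sqrt (1 - k ^ 2 * Real.sin θ ^ 2)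

theorem hasDerivAt_ellipticF {k : ℝ} (hk0 : 0 ≤ k) (hk : k < 1) (φ : ℝ) :
    HasDerivAt (ellipticF k) (1 / Real.sqrt (1 - k ^ 2 * Real.sin φ ^ 2)) φ :=
  (continuous_elliptic_integrand hk0 hk).integral_hasStrictDerivAt 0 φ |>.hasDerivAt

theorem continuous_ellipticF {k : ℝ} (hk0 : 0 ≤ k) (hk : k < 1) : Continuous (ellipticF k) :=
  continuous_iff_continuousAt.mpr fun φ => (hasDerivAt_ellipticF hk0 hk φ).continuousAt

theorem ellipticF_zero (k : ℝ) : ellipticF k 0 = 0 := intervalIntegral.integral_same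

theorem ellipticF_pi_div_two (k : ℝ) : ellipticF k (Real.pi / 2) = ellipticK k := rfl

theorem hasDerivAt_ellipticF_arcsin {k : ℝ} (hk0 : 0 ≤ k) (hk : k < 1) {f : ℝ → ℝ} {f' x : ℝ}
    (hf : HasDerivAt f f' x) (h0 : 0 ≤ f x) (h1 : f x < 1) :
    HasDerivAt (fun x => ellipticF k (Real.arcsin (f x)))
      (f' / (Real.sqrt (1 - f x ^ 2) * Real.sqrt (1 - k ^ 2 * f x ^ 2))) x := by
  have h := (hasDerivAt_ellipticF hk0 hk (Real.arcsin (f x))).comp x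
    ((Real.hasDerivAt_arcsin (by linarith) h1.ne).comp x hf)
  rw [Real.sin_arcsin (by linarith) h1.le] at h
  refine h.congr_deriv ?_
  rw [← div_div]
  ring

theorem sqrt_mul_sqrt_eq {x y c : ℝ} (hx : 0 ≤ x) (hc : 0 ≤ c) (h : x * y = c ^ 2) :
    Real.sqrt x * Real.sqrt y = c := by
  rw [← Real.sqrt_mul hx, h, Real.sqrt_sq hc]

theorem continuous_sechReal {t : ℝ} (ht : 0 < t) : Continuous (sechReal t) :=
  continuous_iff_continuousAt.mpr fun u => (hasDerivAt_sechReal ht u).continuousAt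

/-- Substitute `sin² φ = (a² - D²)/(a² - b²)`, the relation `dn² = 1 - k² sn²` with `dn = D/a`. By
the first integral the incomplete integral then has constant derivative `πa` on `(0, t/2)`, while
`φ` goes from `0` to `π/2`. -/
theorem ellipticK_complementary {t : ℝ} (ht : 0 < t) :
    ellipticK (Real.sqrt (1 - (sechReal t (t / 2) / sechReal t 0) ^ 2)) =
      sechReal t 0 * Real.pi * t / 2 := by
  have hp := Real.pi_pos
  have hab := sechReal_half_lt ht
  have hb := sechReal_pos ht (t / 2)
  set a := sechReal t 0 with ha_def
  set b := sechReal t (t / 2) with hb_def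
  have ha : 0 < a := hb.trans hab
  have hc : 0 < a ^ 2 - b ^ 2 := by nlinarith
  have hba : (b / a) ^ 2 < 1 := by
    rw [div_pow, div_lt_one (by positivity)]
    linarith
  set k := Real.sqrt (1 - (b / a) ^ 2) with hk_def
  have hk0 : 0 ≤ k := Real.sqrt_nonneg _
  have hk2 : k ^ 2 = 1 - (b / a) ^ 2 := Real.sq_sqrt (by linarith)
  have hk : k < 1 := by
    have : 0 < (b / a) ^ 2 := by positivity
    nlinarith
  set u : ℝ → ℝ := fun x => (a ^ 2 - sechReal t x ^ 2) / (a ^ 2 - b ^ 2) with hu_def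
  have hucont : Continuous u := by
    have := continuous_sechReal ht
    fun_prop
  have hderiv : ∀ x ∈ Set.Ioo 0 (t / 2),
      HasDerivAt (fun x => ellipticF k (Real.arcsin (Real.sqrt (u x)))) (a * Real.pi) x := by
    intro x hx
    have hD := sechReal_mem_Ioo ht hx
    have hDpos := sechReal_pos ht x
    have hS := sechTanhReal_pos ht hx
    have hSq := sechTanhReal_sq ht x
    set D := sechReal t x with hD_def
    set S := sechTanhReal t x
    have hu0 : 0 < u x := div_pos (by nlinarith [hD.2]) hc
    have hu1 : u x < 1 := by
      rw [hu_def]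
      simp only
      rw [div_lt_one hc]
      nlinarith [hD.1]
    have hu' : HasDerivAt u (2 * Real.pi * D * S / (a ^ 2 - b ^ 2)) x := by
      refine ((((hasDerivAt_sechReal ht x).fun_pow 2).const_sub (a ^ 2)).div_const
        (a ^ 2 - b ^ 2)).congr_deriv ?_
      push_cast
      ring
    have h1 : Real.sqrt (u x) < 1 := by
      rw [Real.sqrt_lt' one_pos]
      simpa using hu1
    refine (hasDerivAt_ellipticF_arcsin hk0 hk (hu'.sqrt hu0.ne') (Real.sqrt_nonneg _)
      h1).congr_deriv ?_
    rw [Real.sq_sqrt hu0.le, hk2]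
    have e1 : Real.sqrt (u x) * Real.sqrt (1 - u x) = S / (a ^ 2 - b ^ 2) := by
      apply sqrt_mul_sqrt_eq hu0.le (by positivity)
      simp only [hu_def, ← hD_def]
      rw [div_pow, hSq]
      field_simp
      ring
    have e2 : Real.sqrt (1 - (1 - (b / a) ^ 2) * u x) = D / a := by
      rw [Real.sqrt_eq_iff_mul_self_eq_of_pos (by positivity)]
      simp only [hu_def, ← hD_def]
      field_simp
      ring
    have hs1 : 0 < Real.sqrt (u x) := Real.sqrt_pos.mpr hu0
    have hs2 : 0 < Real.sqrt (1 - u x) := Real.sqrt_pos.mpr (by linarith)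
    rw [e2, div_div, show 2 * Real.sqrt (u x) * (Real.sqrt (1 - u x) * (D / a)) =
      2 * (Real.sqrt (u x) * Real.sqrt (1 - u x)) * (D / a) by ring, e1]
    field_simp
  obtain ⟨c, -, hslope⟩ := exists_hasDerivAt_eq_slope _ (fun _ => a * Real.pi) (half_pos ht)
    ((continuous_ellipticF hk0 hk).comp (Real.continuous_arcsin.comp
      (Real.continuous_sqrt.comp hucont))).continuousOn hderiv
  simp only [Function.comp, hu_def, ← ha_def, ← hb_def] at hslope
  rw [div_self hc.ne', sub_self, zero_div, Real.sqrt_one, Real.sqrt_zero, Real.arcsin_one,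
    Real.arcsin_zero, ellipticF_zero, ellipticF_pi_div_two, sub_zero, sub_zero,
    eq_div_iff (by positivity)] at hslope
  linarith

/-- Substitute `sin φ = a / D(iy)`: the incomplete integral has derivative `-πa`, and `φ` falls from
`π/2` at `y = 0` to `0` at the pole `y = 1/2`, reached as a limit. -/
theorem ellipticK_modulus {t : ℝ} (ht : 0 < t) :
    ellipticK (sechReal t (t / 2) / sechReal t 0) = sechReal t 0 * Real.pi / 2 := by
  have hp := Real.pi_pos
  have hab := sechReal_half_lt ht
  have hb := sechReal_pos ht (t / 2)
  set a := sechReal t 0 with ha_def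
  set b := sechReal t (t / 2) with hb_def
  have ha : 0 < a := hb.trans hab
  set k := b / a with hk_def
  have hk0 : 0 ≤ k := by positivity
  have hk : k < 1 := (div_lt_one ha).mpr hab
  have hderiv : ∀ y ∈ Set.Ioo (0 : ℝ) (1 / 2),
      HasDerivAt (fun y => ellipticF k (Real.arcsin (a / sechImag t y))) (-(a * Real.pi)) y := by
    intro y hy
    have hy' : |y| < 1 / 2 := by rw [abs_of_pos hy.1]; exact hy.2
    have hE := sechReal_zero_lt_sechImag ht hy.1 hy.2
    have hs := sechTanhImag_pos ht hy.1 hy.2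
    have hsq := sechTanhImag_sq ht hy'
    have hd := (hasDerivAt_const y a).fun_div (hasDerivAt_sechImag ht hy')
      (ha.trans hE).ne'
    set E := sechImag t y
    set s := sechTanhImag t y
    have hEpos : 0 < E := ha.trans hE
    refine (hasDerivAt_ellipticF_arcsin hk0 hk hd (by positivity)
      ((div_lt_one hEpos).mpr hE)).congr_deriv ?_
    have e1 : Real.sqrt (1 - (a / E) ^ 2) * Real.sqrt (1 - k ^ 2 * (a / E) ^ 2) = s / E ^ 2 := by
      apply sqrt_mul_sqrt_eq _ (by positivity)
      · rw [← ha_def, ← hb_def] at hsq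
        rw [hk_def, div_pow s, hsq]
        field_simp
      · have : (a / E) ^ 2 ≤ 1 := by
          rw [div_pow, div_le_one (by positivity)]
          nlinarith
        linarith
    rw [e1]
    field_simp
    ring
  have hval : ∀ Y ∈ Set.Ioo (0 : ℝ) (1 / 2),
      ellipticF k (Real.arcsin (a / sechImag t Y)) = ellipticK k - a * Real.pi * Y := by
    intro Y hY
    have hcont : ContinuousOn (fun y => ellipticF k (Real.arcsin (a / sechImag t y)))
        (Set.Icc 0 Y) := by
      refine ((continuous_ellipticF hk0 hk).comp Real.continuous_arcsin).comp_continuousOn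
        (continuousOn_const.div (continuousOn_sechImag ht hY.2) fun y hy => ?_)
      exact (ha.trans_le (sechReal_zero_le_sechImag ht hy.1 (hy.2.trans_lt hY.2))).ne'
    obtain ⟨c, -, hslope⟩ := exists_hasDerivAt_eq_slope _ (fun _ => -(a * Real.pi)) hY.1 hcont
      fun y hy => hderiv y ⟨hy.1, hy.2.trans hY.2⟩
    rw [sechImag_zero, ← ha_def, div_self ha.ne', Real.arcsin_one, ellipticF_pi_div_two, sub_zero,
      eq_div_iff hY.1.ne'] at hslope
    linarith
  have hlim : Filter.Tendsto (fun Y => a / sechImag t Y) (nhdsWithin (1 / 2) (Set.Iio (1 / 2)))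
      (nhds 0) := by
    have hcos : Filter.Tendsto (fun Y : ℝ => a * Real.cos (Real.pi * Y))
        (nhdsWithin (1 / 2) (Set.Iio (1 / 2))) (nhds 0) := by
      have : Continuous fun Y : ℝ => a * Real.cos (Real.pi * Y) := by fun_prop
      have h := this.tendsto (1 / 2)
      rw [show Real.pi * (1 / 2) = Real.pi / 2 by ring, Real.cos_pi_div_two, mul_zero] at h
      exact h.mono_left nhdsWithin_le_nhds
    have hev : ∀ᶠ Y in nhdsWithin (1 / 2 : ℝ) (Set.Iio (1 / 2)), Y ∈ Set.Ioo (0 : ℝ) (1 / 2) :=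
      Ioo_mem_nhdsLT (by norm_num)
    refine squeeze_zero' (hev.mono fun Y hY => ?_) (hev.mono fun Y hY => ?_) hcos
    · exact div_nonneg ha.le (sechImag_pos ht (by rw [abs_of_pos hY.1]; exact hY.2)).le
    · have hY' : |Y| < 1 / 2 := by rw [abs_of_pos hY.1]; exact hY.2
      have h1 := inv_cos_le_sechSum_mul_I ht hY'
      have h2 : 0 < Real.cos (Real.pi * Y) := by
        apply Real.cos_pos_of_mem_Ioo
        constructor <;> nlinarith [hY.1, hY.2]
      rw [div_eq_mul_inv]
      gcongr
      rw [inv_le_comm₀ (sechImag_pos ht hY') h2]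
      exact h1
  have hev : ∀ᶠ Y in nhdsWithin (1 / 2 : ℝ) (Set.Iio (1 / 2)),
      ellipticF k (Real.arcsin (a / sechImag t Y)) = ellipticK k - a * Real.pi * Y :=
    Filter.mem_of_superset (Ioo_mem_nhdsLT (by norm_num : (0 : ℝ) < 1 / 2)) hval
  have l1 := (((continuous_ellipticF hk0 hk).comp Real.continuous_arcsin).tendsto 0).comp hlim
  have l2 : Filter.Tendsto (fun Y : ℝ => ellipticK k - a * Real.pi * Y)
      (nhdsWithin (1 / 2) (Set.Iio (1 / 2))) (nhds (ellipticK k - a * Real.pi * (1 / 2))) := by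
    have : Continuous fun Y : ℝ => ellipticK k - a * Real.pi * Y := by fun_prop
    exact (this.tendsto _).mono_left nhdsWithin_le_nhds
  have h := tendsto_nhds_unique (l1.congr' hev) l2
  simp only [Function.comp, Real.arcsin_zero, ellipticF_zero] at h
  linarith

theorem ellipticK_pos {k : ℝ} (hk0 : 0 ≤ k) (hk : k < 1) : 0 < ellipticK k :=
  intervalIntegral.intervalIntegral_pos_of_pos
    ((continuous_elliptic_integrand hk0 hk).intervalIntegrable _ _)
    (fun θ => one_div_pos.mpr (Real.sqrt_pos.mpr (one_sub_sq_mul_sin_sq_pos hk0 hk θ)))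
    (by positivity)

theorem ellipticK_lt_ellipticK {k l : ℝ} (hk0 : 0 ≤ k) (hkl : k < l) (hl : l < 1) :
    ellipticK k < ellipticK l := by
  have hp := Real.pi_pos
  refine intervalIntegral.integral_lt_integral_of_continuousOn_of_le_of_exists_lt (by positivity)
    (continuous_elliptic_integrand hk0 (hkl.trans hl)).continuousOn
    (continuous_elliptic_integrand (hk0.trans hkl.le) hl).continuousOn
    (fun θ _ => ?_) ⟨Real.pi / 2, ⟨by positivity, le_rfl⟩, ?_⟩
  · have h := one_sub_sq_mul_sin_sq_pos (hk0.trans hkl.le) hl θ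
    gcongr
  · have h := one_sub_sq_mul_sin_sq_pos (hk0.trans hkl.le) hl (Real.pi / 2)
    rw [Real.sin_pi_div_two] at h ⊢
    have : k ^ 2 < l ^ 2 := by nlinarith
    apply one_div_lt_one_div_of_lt (Real.sqrt_pos.mpr h)
    apply Real.sqrt_lt_sqrt h.le
    linarith

/-! ### The singular modulus and the Lambert series. -/

theorem IsSingularModulus.unique {r k l : ℝ} (hk : IsSingularModulus r k)
    (hl : IsSingularModulus r l) : k = l := by
  have aux : ∀ {k l : ℝ}, IsSingularModulus r k → IsSingularModulus r l → ¬ k < l := by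
    intro k l hk hl hlt
    have h1 := ellipticK_lt_ellipticK hk.1.le hlt hl.2.1
    have hsq : k ^ 2 < l ^ 2 := by nlinarith [hk.1]
    have hl1 : l ^ 2 < 1 := by nlinarith [hl.1, hl.2.1]
    have h2 : Real.sqrt (1 - l ^ 2) < Real.sqrt (1 - k ^ 2) :=
      Real.sqrt_lt_sqrt (by linarith) (by linarith)
    have h3 : Real.sqrt (1 - k ^ 2) < 1 := by
      rw [Real.sqrt_lt' one_pos]
      have := pow_pos hk.1 2
      linarith
    have h4 := ellipticK_lt_ellipticK (Real.sqrt_nonneg _) h2 h3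
    have h5 := ellipticK_pos (Real.sqrt_nonneg _) (h2.trans h3)
    have h6 := ellipticK_pos hk.1.le hk.2.1
    have h7 : ellipticK (Real.sqrt (1 - l ^ 2)) / ellipticK l <
        ellipticK (Real.sqrt (1 - k ^ 2)) / ellipticK k :=
      div_lt_div₀ h4 h1.le (h5.trans h4).le h6
    rw [hk.2.2, hl.2.2] at h7
    exact lt_irrefl _ h7
  rcases lt_trichotomy k l with h | h | h
  · exact absurd h (aux hk hl)
  · exact h
  · exact absurd h (aux hl hk)

/-- The two complete integrals are `πat/2` and `πa/2`, with quotient `t = √r`. This also proves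
existence, without a continuity argument for `K'/K`. -/
theorem isSingularModulus_sechReal {r : ℝ} (hr : 0 < r) :
    IsSingularModulus r (sechReal (Real.sqrt r) (Real.sqrt r / 2) / sechReal (Real.sqrt r) 0) := by
  have ht := Real.sqrt_pos.mpr hr
  have ha := sechReal_pos ht 0
  refine ⟨div_pos (sechReal_pos ht _) ha, (div_lt_one ha).mpr (sechReal_half_lt ht), ?_⟩
  rw [ellipticK_complementary ht, ellipticK_modulus ht]
  have := Real.pi_pos
  field_simp

theorem singularModulus_eq {r : ℝ} (hr : 0 < r) :
    singularModulus r =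
      sechReal (Real.sqrt r) (Real.sqrt r / 2) / sechReal (Real.sqrt r) 0 :=
  IsSingularModulus.unique (Classical.epsilon_spec ⟨_, isSingularModulus_sechReal hr⟩)
    (isSingularModulus_sechReal hr)

theorem quarterK_eq {r : ℝ} (hr : 0 < r) :
    quarterK r = sechReal (Real.sqrt r) 0 * Real.pi / 2 := by
  rw [quarterK, singularModulus_eq hr, ellipticK_modulus (Real.sqrt_pos.mpr hr)]

theorem quarterK'_eq {r : ℝ} (hr : 0 < r) : quarterK' r = quarterK r * Real.sqrt r := by
  rw [quarterK_eq hr, quarterK', singularModulus_eq hr,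
    ellipticK_complementary (Real.sqrt_pos.mpr hr)]
  ring

theorem quarterK_pos {r : ℝ} (hr : 0 < r) : 0 < quarterK r := by
  rw [quarterK_eq hr]
  have := sechReal_pos (Real.sqrt_pos.mpr hr) 0
  have := Real.pi_pos
  positivity

theorem nome_pos (r : ℝ) : 0 < nome r := Real.exp_pos _

theorem nome_lt_one {r : ℝ} (hr : 0 < r) : nome r < 1 := by
  rw [nome, Real.exp_lt_one_iff]
  have := mul_pos Real.pi_pos (Real.sqrt_pos.mpr hr)
  linarith

theorem nome_rpow (r x : ℝ) : nome r ^ x = Real.exp (-(Real.pi * Real.sqrt r * x)) := by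
  rw [nome, ← Real.exp_mul]
  congr 1
  ring

theorem lambertTerm_eq (r : ℝ) (n : ℕ) :
    nome r ^ ((n : ℝ) + 1 / 2) / (1 + nome r ^ (2 * n + 1)) =
      (Real.cosh (Real.pi * (Real.sqrt r / 2 + n * Real.sqrt r)))⁻¹ / 2 := by
  rw [← Real.rpow_natCast, nome_rpow, nome_rpow, Real.cosh_eq]
  set v := Real.pi * (Real.sqrt r / 2 + n * Real.sqrt r) with hv
  have h1 : -(Real.pi * Real.sqrt r * ((n : ℝ) + 1 / 2)) = -v := by rw [hv]; ring
  have h2 : -(Real.pi * Real.sqrt r * ((2 * n + 1 : ℕ) : ℝ)) = -v + -v := by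
    rw [hv]
    push_cast
    ring
  rw [h1, h2, Real.exp_add]
  have h3 : Real.exp v * Real.exp (-v) = 1 := by rw [← Real.exp_add]; simp
  have := Real.exp_pos v
  have := Real.exp_pos (-v)
  field_simp
  linear_combination h3

/-- The Lambert series of `K k / (2 π)`. -/
theorem hasSum_lambert {r : ℝ} (hr : 0 < r) :
    HasSum (fun n : ℕ => nome r ^ ((n : ℝ) + 1 / 2) / (1 + nome r ^ (2 * n + 1)))
      (quarterK r * singularModulus r / (2 * Real.pi)) := by
  set t := Real.sqrt r with ht_def
  have ht : 0 < t := Real.sqrt_pos.mpr hr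
  have hz := ofReal_mem_strip (t / 2)
  have hs : Summable fun n => sechTerm t n ((t / 2 : ℝ) : ℂ) :=
    ((boxBounded_sechTerm ht).summable_norm ht hz).of_norm
  have hterm : ∀ n : ℤ, sechTerm t n ((t / 2 : ℝ) : ℂ) =
      (((Real.cosh (Real.pi * (t / 2 - n * t)))⁻¹ : ℝ) : ℂ) := by
    intro n
    rw [sechTerm]
    push_cast
    rfl
  have h := Complex.hasSum_re hs.hasSum
  simp only [hterm, Complex.ofReal_re] at h
  have hval : (∑' n : ℤ, (((Real.cosh (Real.pi * (t / 2 - n * t)))⁻¹ : ℝ) : ℂ)).re =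
      sechReal t (t / 2) := by
    simp only [sechReal, sechSum, hterm]
  rw [hval] at h
  have h1 := (Equiv.neg ℤ).hasSum_iff.mpr h
  -- The indices `n` and `-(n+1)` have opposite arguments `±π(t/2 + nt)`, so each pair is twice a
  -- secant and four times a Lambert term.
  have h2 := h1.nat_add_neg_add_one
  have hK : quarterK r * singularModulus r / (2 * Real.pi) = sechReal t (t / 2) * (1 / 4) := by
    rw [quarterK_eq hr, singularModulus_eq hr, ← ht_def]
    have := Real.pi_pos
    have := sechReal_pos ht 0
    field_simp
    ring
  rw [hK]
  refine (h2.mul_right (1 / 4)).congr_fun fun n => ?_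
  rw [lambertTerm_eq, ← ht_def]
  simp only [Function.comp, Equiv.neg_apply]
  have e1 : t / 2 - ((-(n : ℤ) : ℤ) : ℝ) * t = t / 2 + n * t := by push_cast; ring
  have e2 : t / 2 - ((- -((n : ℤ) + 1) : ℤ) : ℝ) * t = -(t / 2 + n * t) := by push_cast; ring
  rw [e1, e2, mul_neg, Real.cosh_neg]
  ring

/-! ### Meromorphic continuation of the cosine series. -/

open Filter Topology

/-- The `k`-th term of the Lambert-type series that continues one half of the series of `cd₁`. -/
noncomputable def cdHalfTerm (q : ℝ) (k : ℕ) (v : ℂ) : ℂ :=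
  ((q ^ ((k : ℝ) + 1 / 2) : ℝ) : ℂ) * Complex.exp v ^ 3 /
    (1 + (q : ℂ) ^ (2 * k + 1) * Complex.exp v ^ 2)

/-- The sum of the series with terms `cdHalfTerm`. -/
noncomputable def cdHalf (q : ℝ) (v : ℂ) : ℂ := ∑' k : ℕ, cdHalfTerm q k v

theorem rpow_natCast_add_half {q : ℝ} (hq : 0 < q) (k : ℕ) :
    q ^ ((k : ℝ) + 1 / 2) = q ^ k * q ^ (1 / 2 : ℝ) := by
  rw [Real.rpow_add hq, Real.rpow_natCast]

theorem summable_rpow_natCast_add_half {q : ℝ} (hq : 0 < q) (hq1 : q < 1) :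
    Summable fun k : ℕ => q ^ ((k : ℝ) + 1 / 2) := by
  simp only [rpow_natCast_add_half hq]
  exact (summable_geometric_of_lt_one hq.le hq1).mul_right _

theorem norm_exp_le_of_mem_ball {v₀ v : ℂ} (hv : v ∈ Metric.ball v₀ 1) :
    ‖Complex.exp v‖ ≤ Real.exp (v₀.re + 1) := by
  rw [Complex.norm_exp, Real.exp_le_exp]
  have h1 := Complex.abs_re_le_norm (v - v₀)
  rw [Metric.mem_ball, dist_eq_norm] at hv
  rw [Complex.sub_re] at h1
  linarith [le_abs_self (v.re - v₀.re)]

/-- On a ball `|e^v|` is bounded by some `M`; once `q^{k₀} M² < 1/2`, all later denominators have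
modulus at least `1/2`. -/
theorem exists_cdHalfTerm_tail {q : ℝ} (hq : 0 < q) (hq1 : q < 1) (v₀ : ℂ) :
    ∃ k₀ : ℕ, ∀ k : ℕ, ∀ v ∈ Metric.ball v₀ 1,
      1 + (q : ℂ) ^ (2 * (k + k₀) + 1) * Complex.exp v ^ 2 ≠ 0 ∧
      ‖cdHalfTerm q (k + k₀) v‖ ≤
        2 * Real.exp (v₀.re + 1) ^ 3 * q ^ (((k + k₀ : ℕ) : ℝ) + 1 / 2) := by
  set M := Real.exp (v₀.re + 1) with hM
  have hMpos : 0 < M := Real.exp_pos _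
  obtain ⟨k₀, hk₀⟩ := exists_pow_lt_of_lt_one (show 0 < 1 / (2 * M ^ 2) by positivity) hq1
  refine ⟨k₀, fun k v hv => ?_⟩
  have hexp := norm_exp_le_of_mem_ball hv
  have h1 : ‖(q : ℂ) ^ (2 * (k + k₀) + 1) * Complex.exp v ^ 2‖ ≤ 1 / 2 := by
    rw [norm_mul, norm_pow, norm_pow, Complex.norm_real, Real.norm_of_nonneg hq.le]
    calc q ^ (2 * (k + k₀) + 1) * ‖Complex.exp v‖ ^ 2 ≤ q ^ k₀ * M ^ 2 := by
          gcongr ?_ * ?_ ^ 2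
          exact pow_le_pow_of_le_one hq.le hq1.le (by omega)
      _ ≤ 1 / (2 * M ^ 2) * M ^ 2 := by gcongr
      _ = 1 / 2 := by field_simp
  have h2 : 1 / 2 ≤ ‖1 + (q : ℂ) ^ (2 * (k + k₀) + 1) * Complex.exp v ^ 2‖ := by
    have := norm_sub_norm_le (1 : ℂ) (-((q : ℂ) ^ (2 * (k + k₀) + 1) * Complex.exp v ^ 2))
    rw [norm_neg, sub_neg_eq_add, norm_one] at this
    linarith
  refine ⟨norm_pos_iff.mp (by linarith), ?_⟩
  rw [cdHalfTerm, norm_div, norm_mul, norm_pow, Complex.norm_real,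
    Real.norm_of_nonneg (by positivity), div_le_iff₀ (by linarith)]
  calc q ^ (((k + k₀ : ℕ) : ℝ) + 1 / 2) * ‖Complex.exp v‖ ^ 3
      ≤ q ^ (((k + k₀ : ℕ) : ℝ) + 1 / 2) * M ^ 3 := by gcongr
    _ = 2 * M ^ 3 * q ^ (((k + k₀ : ℕ) : ℝ) + 1 / 2) * (1 / 2) := by ring
    _ ≤ _ := by gcongr

theorem analyticAt_cdHalfTerm {q : ℝ} {k : ℕ} {v : ℂ}
    (h : 1 + (q : ℂ) ^ (2 * k + 1) * Complex.exp v ^ 2 ≠ 0) : AnalyticAt ℂ (cdHalfTerm q k) v := by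
  unfold cdHalfTerm
  exact AnalyticAt.fun_div (by fun_prop) (by fun_prop) h

theorem meromorphicAt_cdHalfTerm (q : ℝ) (k : ℕ) (v : ℂ) : MeromorphicAt (cdHalfTerm q k) v := by
  have h1 : AnalyticAt ℂ (fun v => ((q ^ ((k : ℝ) + 1 / 2) : ℝ) : ℂ) * Complex.exp v ^ 3) v := by
    fun_prop
  have h2 : AnalyticAt ℂ (fun v => 1 + (q : ℂ) ^ (2 * k + 1) * Complex.exp v ^ 2) v := by
    fun_prop
  exact h1.meromorphicAt.div h2.meromorphicAt

theorem cdHalf_eventuallyEq {q : ℝ} (hq : 0 < q) (hq1 : q < 1) (v₀ : ℂ) :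
    ∃ (k₀ : ℕ) (T : ℂ → ℂ), AnalyticAt ℂ T v₀ ∧
      cdHalf q =ᶠ[𝓝 v₀] fun v => (∑ k ∈ Finset.range k₀, cdHalfTerm q k v) + T v := by
  obtain ⟨k₀, hk₀⟩ := exists_cdHalfTerm_tail hq hq1 v₀
  have hs : Summable fun k : ℕ =>
      2 * Real.exp (v₀.re + 1) ^ 3 * q ^ (((k + k₀ : ℕ) : ℝ) + 1 / 2) :=
    ((summable_nat_add_iff k₀).mpr (summable_rpow_natCast_add_half hq hq1)).mul_left _
  have hT : DifferentiableOn ℂ (fun v => ∑' k : ℕ, cdHalfTerm q (k + k₀) v) (Metric.ball v₀ 1) :=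
    Complex.differentiableOn_tsum_of_summable_norm hs
      (fun k v hv => (analyticAt_cdHalfTerm (hk₀ k v hv).1).differentiableAt.differentiableWithinAt)
      Metric.isOpen_ball fun k v hv => (hk₀ k v hv).2
  refine ⟨k₀, fun v => ∑' k : ℕ, cdHalfTerm q (k + k₀) v, hT.analyticAt (Metric.ball_mem_nhds v₀ one_pos), ?_⟩
  filter_upwards [Metric.ball_mem_nhds v₀ one_pos] with v hv
  let G : ℕ → ℂ := fun k => cdHalfTerm q k v
  have hsv : Summable fun k : ℕ => G (k + k₀) :=
    Summable.of_norm_bounded hs fun k => (hk₀ k v hv).2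
  have hG : Summable G := (summable_nat_add_iff k₀).mp hsv
  exact (hG.sum_add_tsum_nat_add k₀).symm

theorem meromorphicAt_cdHalf {q : ℝ} (hq : 0 < q) (hq1 : q < 1) (v : ℂ) :
    MeromorphicAt (cdHalf q) v := by
  obtain ⟨k₀, T, hT, h⟩ := cdHalf_eventuallyEq hq hq1 v
  have hsum : MeromorphicAt (fun v => ∑ k ∈ Finset.range k₀, cdHalfTerm q k v) v :=
    MeromorphicAt.fun_sum fun k _ => meromorphicAt_cdHalfTerm q k v
  exact (hsum.add hT.meromorphicAt).congr (h.symm.filter_mono nhdsWithin_le_nhds)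

theorem analyticAt_cdHalf {q : ℝ} (hq : 0 < q) (hq1 : q < 1) {v : ℂ}
    (hv : ∀ k : ℕ, 1 + (q : ℂ) ^ (2 * k + 1) * Complex.exp v ^ 2 ≠ 0) :
    AnalyticAt ℂ (cdHalf q) v := by
  obtain ⟨k₀, T, hT, h⟩ := cdHalf_eventuallyEq hq hq1 v
  have hsum : AnalyticAt ℂ (fun v => ∑ k ∈ Finset.range k₀, cdHalfTerm q k v) v :=
    Finset.analyticAt_fun_sum _ fun k _ => analyticAt_cdHalfTerm (hv k)
  exact (hsum.add hT).congr h.symm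

theorem norm_pow_mul_exp_sq_lt_one {q : ℝ} (hq : 0 < q) (hq1 : q < 1) {v : ℂ}
    (hv : q * Real.exp (2 * v.re) < 1) (k : ℕ) :
    ‖(q : ℂ) ^ (2 * k + 1) * Complex.exp v ^ 2‖ < 1 := by
  rw [norm_mul, norm_pow, norm_pow, Complex.norm_real, Real.norm_of_nonneg hq.le,
    Complex.norm_exp, ← Real.exp_nat_mul]
  refine lt_of_le_of_lt ?_ hv
  push_cast
  gcongr
  exact pow_le_of_le_one hq.le hq1.le (by omega)

theorem one_add_ne_zero_of_lt {q : ℝ} (hq : 0 < q) (hq1 : q < 1) {v : ℂ}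
    (hv : q * Real.exp (2 * v.re) < 1) (k : ℕ) :
    1 + (q : ℂ) ^ (2 * k + 1) * Complex.exp v ^ 2 ≠ 0 := by
  intro h
  have h1 := norm_pow_mul_exp_sq_lt_one hq hq1 hv k
  rw [← norm_neg, neg_eq_of_add_eq_zero_left h, norm_one] at h1
  exact lt_irrefl _ h1

/-- Expansion of `cdHalf` into an exponential series. -/
theorem hasSum_cdHalf {q : ℝ} (hq : 0 < q) (hq1 : q < 1) {v : ℂ}
    (hv : q * Real.exp (2 * v.re) < 1) :
    HasSum (fun n : ℕ => (-1 : ℂ) ^ n * ((q ^ ((n : ℝ) + 1 / 2) : ℝ) : ℂ)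
      * Complex.exp v ^ (2 * n + 3) / (1 - (q : ℂ) ^ (2 * n + 1))) (cdHalf q v) := by
  set x := Complex.exp v with hx
  set ρ : ℂ := ((q ^ (1 / 2 : ℝ) : ℝ) : ℂ) with hρ
  have hρk : ∀ k : ℕ, ((q ^ ((k : ℝ) + 1 / 2) : ℝ) : ℂ) = (q : ℂ) ^ k * ρ := by
    intro k
    rw [rpow_natCast_add_half hq]
    push_cast
    rfl
  have hqn : ‖(q : ℂ)‖ = q := by rw [Complex.norm_real, Real.norm_of_nonneg hq.le]
  have hx2 : ‖x ^ 2‖ = Real.exp (2 * v.re) := by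
    rw [norm_pow, Complex.norm_exp, ← Real.exp_nat_mul]
    norm_num
  -- The double series behind both expansions: summing over the second index gives the exponential
  -- series, over the first the terms `cdHalfTerm`. It is majorized by a product of geometric series
  -- because `q^{k(2n+1)} ≤ q^k`.
  let F : ℕ × ℕ → ℂ := fun p => ρ * x ^ 3 * (-((q : ℂ) * x ^ 2)) ^ p.1 * (q : ℂ) ^ (p.2 * (2 * p.1 + 1))
  have hF : Summable F := by
    have h1 : Summable fun n : ℕ => ‖ρ * x ^ 3‖ * (q * Real.exp (2 * v.re)) ^ n :=
      (summable_geometric_of_lt_one (by positivity) hv).mul_left _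
    have h2 : Summable fun k : ℕ => q ^ k := summable_geometric_of_lt_one hq.le hq1
    refine Summable.of_norm_bounded (h1.mul_of_nonneg h2 (fun _ => by positivity)
      (fun _ => by positivity)) fun p => ?_
    simp only [F]
    rw [norm_mul, norm_mul, norm_pow, norm_pow _ (_ * _), norm_neg, norm_mul (q : ℂ), hqn, hx2]
    gcongr ?_ * ?_
    · exact pow_le_pow_of_le_one hq.le hq1.le (Nat.le_mul_of_pos_right _ (by omega))
  have hrow : ∀ n : ℕ, HasSum (fun k : ℕ => F (n, k)) ((-1 : ℂ) ^ n *
      ((q ^ ((n : ℝ) + 1 / 2) : ℝ) : ℂ) * x ^ (2 * n + 3) / (1 - (q : ℂ) ^ (2 * n + 1))) := by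
    intro n
    have hlt : ‖(q : ℂ) ^ (2 * n + 1)‖ < 1 := by
      rw [norm_pow, hqn]
      exact pow_lt_one₀ hq.le hq1 (by omega)
    have h := (hasSum_geometric_of_norm_lt_one hlt).mul_left (ρ * x ^ 3 * (-((q : ℂ) * x ^ 2)) ^ n)
    have e : ((-1 : ℂ) ^ n * ((q ^ ((n : ℝ) + 1 / 2) : ℝ) : ℂ) * x ^ (2 * n + 3) /
        (1 - (q : ℂ) ^ (2 * n + 1))) =
        ρ * x ^ 3 * (-((q : ℂ) * x ^ 2)) ^ n * (1 - (q : ℂ) ^ (2 * n + 1))⁻¹ := by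
      rw [hρk, neg_pow ((q : ℂ) * x ^ 2), mul_pow]
      ring
    rw [e]
    refine h.congr_fun fun k => ?_
    simp only [F]
    rw [← pow_mul, mul_comm k]
  have hcol : ∀ k : ℕ, HasSum (fun n : ℕ => F (n, k)) (cdHalfTerm q k v) := by
    intro k
    have hlt : ‖-((q : ℂ) ^ (2 * k + 1) * x ^ 2)‖ < 1 := by
      rw [norm_neg]
      exact norm_pow_mul_exp_sq_lt_one hq hq1 hv k
    have h := (hasSum_geometric_of_norm_lt_one hlt).mul_left (ρ * x ^ 3 * (q : ℂ) ^ k)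
    have e : cdHalfTerm q k v =
        ρ * x ^ 3 * (q : ℂ) ^ k * (1 - -((q : ℂ) ^ (2 * k + 1) * x ^ 2))⁻¹ := by
      rw [cdHalfTerm, hρk, sub_neg_eq_add]
      ring
    rw [e]
    refine h.congr_fun fun n => ?_
    simp only [F]
    rw [neg_pow, neg_pow ((q : ℂ) ^ (2 * k + 1) * x ^ 2), mul_pow, mul_pow, ← pow_mul]
    ring
  have hswap : HasSum (F ∘ (Equiv.prodComm ℕ ℕ)) (∑' p, F p) :=
    (Equiv.prodComm ℕ ℕ).hasSum_iff.mpr hF.hasSum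
  have h1 : HasSum (fun k => cdHalfTerm q k v) (∑' p, F p) := hswap.prod_fiberwise hcol
  rw [cdHalf, h1.tsum_eq]
  exact hF.hasSum.prod_fiberwise hrow

/-! ### Values where `e^v` is plus or minus an integral power of `q`. -/

theorem hasSum_nat_shift_sub {a : ℕ → ℝ} {S : ℝ} (h : HasSum a S) (N : ℕ) :
    HasSum (fun k => a (k + N)) (S - ∑ j ∈ Finset.range N, a j) :=
  (hasSum_nat_add_iff' N).mpr h

/-- The sum of a sequence that is preceded by its reflected first `N` terms. -/
theorem hasSum_reflect {a b : ℕ → ℝ} {S : ℝ} (h : HasSum a S) (N : ℕ)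
    (h1 : ∀ k, b (k + N) = a k) (h2 : ∀ j < N, b j = a (N - 1 - j)) :
    HasSum b (S + ∑ j ∈ Finset.range N, a j) := by
  have h3 : ∑ j ∈ Finset.range N, b j = ∑ j ∈ Finset.range N, a j := by
    rw [← Finset.sum_range_reflect a N]
    exact Finset.sum_congr rfl fun j hj => h2 j (Finset.mem_range.mp hj)
  rw [← h3]
  exact (hasSum_nat_add_iff N).mp (by simpa only [h1] using h)

theorem cdHalfTerm_of_exp_eq_pow {q : ℝ} (hq : 0 < q) {v : ℂ} {ε : ℝ} (hε : ε ^ 2 = 1) (N : ℕ)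
    (hv : Complex.exp v = (ε * q ^ N : ℝ)) (k : ℕ) :
    cdHalfTerm q k v = ((ε * q ^ (2 * N) * (q ^ (((k + N : ℕ) : ℝ) + 1 / 2) /
      (1 + q ^ (2 * (k + N) + 1))) : ℝ) : ℂ) := by
  rw [cdHalfTerm, hv]
  norm_cast
  rw [rpow_natCast_add_half hq, rpow_natCast_add_half hq, mul_pow, mul_pow, hε,
    show ε ^ 3 = ε by rw [pow_succ, hε, one_mul]]
  have e : q ^ (2 * k + 1) * (1 * (q ^ N) ^ 2) = q ^ (2 * (k + N) + 1) := by ring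
  rw [e]
  ring

theorem cdHalfTerm_of_exp_eq_inv_pow {q : ℝ} (hq : 0 < q) {v : ℂ} {ε : ℝ} (hε : ε ^ 2 = 1) (N : ℕ)
    (hv : Complex.exp v = (ε * (q ^ N)⁻¹ : ℝ)) (k : ℕ) :
    cdHalfTerm q k v = ((ε * (q ^ (2 * N))⁻¹ * (q ^ k * q ^ (1 / 2 : ℝ) * (q ^ N)⁻¹ /
      (1 + q ^ (2 * k + 1) * (q ^ (2 * N))⁻¹)) : ℝ) : ℂ) := by
  rw [cdHalfTerm, hv]
  norm_cast
  rw [rpow_natCast_add_half hq, mul_pow, mul_pow, hε,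
    show ε ^ 3 = ε by rw [pow_succ, hε, one_mul]]
  have e : q ^ (2 * k + 1) * (1 * (q ^ N)⁻¹ ^ 2) = q ^ (2 * k + 1) * (q ^ (2 * N))⁻¹ := by
    rw [one_mul, inv_pow, ← pow_mul, mul_comm N]
  rw [e]
  ring

theorem cdHalf_of_exp_eq_pow {q : ℝ} (hq : 0 < q) {v : ℂ} {ε S : ℝ} (hε : ε ^ 2 = 1) (N : ℕ)
    (hv : Complex.exp v = (ε * q ^ N : ℝ))
    (hS : HasSum (fun n : ℕ => q ^ ((n : ℝ) + 1 / 2) / (1 + q ^ (2 * n + 1))) S) :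
    cdHalf q v = ((ε * q ^ (2 * N) *
      (S - ∑ j ∈ Finset.range N, q ^ ((j : ℝ) + 1 / 2) / (1 + q ^ (2 * j + 1))) : ℝ) : ℂ) := by
  have h := (hasSum_nat_shift_sub hS N).mul_left (ε * q ^ (2 * N))
  rw [cdHalf]
  simp only [cdHalfTerm_of_exp_eq_pow hq hε N hv]
  exact (Complex.hasSum_ofReal.mpr h).tsum_eq

theorem cdHalf_of_exp_eq_inv_pow {q : ℝ} (hq : 0 < q) {v : ℂ} {ε S : ℝ} (hε : ε ^ 2 = 1) (N : ℕ)
    (hv : Complex.exp v = (ε * (q ^ N)⁻¹ : ℝ))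
    (hS : HasSum (fun n : ℕ => q ^ ((n : ℝ) + 1 / 2) / (1 + q ^ (2 * n + 1))) S) :
    cdHalf q v = ((ε * (q ^ (2 * N))⁻¹ *
      (S + ∑ j ∈ Finset.range N, q ^ ((j : ℝ) + 1 / 2) / (1 + q ^ (2 * j + 1))) : ℝ) : ℂ) := by
  have h0 := hasSum_reflect (b := fun k => q ^ k * q ^ (1 / 2 : ℝ) * (q ^ N)⁻¹ /
      (1 + q ^ (2 * k + 1) * (q ^ (2 * N))⁻¹)) hS N
    (fun k => by
      have e1 : q ^ (k + N) * q ^ (1 / 2 : ℝ) * (q ^ N)⁻¹ = q ^ ((k : ℝ) + 1 / 2) := by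
        rw [rpow_natCast_add_half hq, pow_add]
        field_simp
      have e2 : q ^ (2 * (k + N) + 1) * (q ^ (2 * N))⁻¹ = q ^ (2 * k + 1) := by
        rw [show 2 * (k + N) + 1 = 2 * k + 1 + 2 * N by ring, pow_add]
        field_simp
      simp only [e1, e2])
    -- The Lambert term is invariant under `n ↦ -1 - n`, so the index `j - N` may be replaced by `N
    -- - 1 - j`.
    (fun j hj => by
      obtain ⟨i, rfl⟩ : ∃ i, N = i + j + 1 := ⟨N - 1 - j, by omega⟩
      rw [show i + j + 1 - 1 - j = i by omega, rpow_natCast_add_half hq]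
      have hpos := Real.rpow_pos_of_pos hq (1 / 2)
      have hhalf : q ^ (1 / 2 : ℝ) * q ^ (1 / 2 : ℝ) = q := by
        rw [← Real.rpow_add hq]
        norm_num
      generalize q ^ (1 / 2 : ℝ) = s at hpos hhalf
      rw [div_eq_div_iff (by positivity) (by positivity)]
      field_simp
      ring)
  have h := h0.mul_left (ε * (q ^ (2 * N))⁻¹)
  rw [cdHalf]
  simp only [cdHalfTerm_of_exp_eq_inv_pow hq hε N hv]
  exact (Complex.hasSum_ofReal.mpr h).tsum_eq

/-! ### Normal forms and the identification of `cdOne`. -/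

theorem toMeromorphicNFOn_eventuallyEq_of_analyticAt {f : ℂ → ℂ} (hf : MeromorphicOn f Set.univ)
    {z : ℂ} (hz : AnalyticAt ℂ f z) : toMeromorphicNFOn f Set.univ =ᶠ[𝓝 z] f :=
  ((meromorphicNFOn_toMeromorphicNFOn f Set.univ
    (Set.mem_univ z)).eventuallyEq_nhdsNE_iff_eventuallyEq_nhds hz.meromorphicNFAt).mp
    (hf.toMeromorphicNFOn_eq_self_on_nhdsNE (Set.mem_univ z))

/-- The identity theorem for meromorphic functions in normal form. -/
theorem MeromorphicNFOn.eq_of_eventuallyEq {f g : ℂ → ℂ} (hf : MeromorphicNFOn f Set.univ)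
    (hg : MeromorphicNFOn g Set.univ) {z₀ : ℂ} (h : f =ᶠ[𝓝 z₀] g) : f = g := by
  have hsub : MeromorphicOn (f - g) Set.univ := hf.meromorphicOn.sub hg.meromorphicOn
  have h0 : meromorphicOrderAt (f - g) z₀ = ⊤ := by
    rw [meromorphicOrderAt_eq_top_iff]
    refine Filter.Eventually.filter_mono nhdsWithin_le_nhds (h.mono fun z hz => ?_)
    rw [Pi.sub_apply, hz, sub_self]
  funext z
  have h1 : meromorphicOrderAt (f - g) z = ⊤ := by
    by_contra hne
    exact hsub.meromorphicOrderAt_ne_top_of_isPreconnected isPreconnected_univ (Set.mem_univ z)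
      (Set.mem_univ z₀) hne h0
  rw [meromorphicOrderAt_eq_top_iff] at h1
  have h2 : f =ᶠ[𝓝[≠] z] g := h1.mono fun w hw => sub_eq_zero.mp hw
  exact (((hf (Set.mem_univ z)).eventuallyEq_nhdsNE_iff_eventuallyEq_nhds
    (hg (Set.mem_univ z))).mp h2).eq_of_nhds

/-- The variable `I π u / (2 K)`. -/
noncomputable def cdArg (r : ℝ) (u : ℂ) : ℂ :=
  Complex.I * (Real.pi / (2 * quarterK r)) * u

/-- The continuation of the series of `cd₁`, before normalization at the poles. -/
noncomputable def cdOneSum (r : ℝ) (u : ℂ) : ℂ :=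
  2 * (Real.pi : ℂ) / ((quarterK r : ℂ) * (singularModulus r : ℂ)) *
    ((cdHalf (nome r) (cdArg r u) + cdHalf (nome r) (-cdArg r u)) / 2)

theorem analyticAt_cdArg (r : ℝ) (u : ℂ) : AnalyticAt ℂ (cdArg r) u := by
  unfold cdArg
  fun_prop

theorem meromorphicOn_cdOneSum {r : ℝ} (hr : 0 < r) : MeromorphicOn (cdOneSum r) Set.univ := by
  intro u _
  have h := fun v => meromorphicAt_cdHalf (nome_pos r) (nome_lt_one hr) v
  have h1 : MeromorphicAt (fun u => cdHalf (nome r) (cdArg r u)) u :=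
    (h _).comp_analyticAt (analyticAt_cdArg r u)
  have h2 : MeromorphicAt (fun u => cdHalf (nome r) (-cdArg r u)) u :=
    (h _).comp_analyticAt (analyticAt_cdArg r u).neg
  exact (MeromorphicAt.const _ u).mul ((h1.add h2).div (MeromorphicAt.const 2 u))

theorem analyticAt_cdOneSum {r : ℝ} (hr : 0 < r) {u : ℂ}
    (h1 : ∀ k : ℕ, 1 + (nome r : ℂ) ^ (2 * k + 1) * Complex.exp (cdArg r u) ^ 2 ≠ 0)
    (h2 : ∀ k : ℕ, 1 + (nome r : ℂ) ^ (2 * k + 1) * Complex.exp (-cdArg r u) ^ 2 ≠ 0) :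
    AnalyticAt ℂ (cdOneSum r) u := by
  have a1 : AnalyticAt ℂ (fun u => cdHalf (nome r) (cdArg r u)) u :=
    (analyticAt_cdHalf (nome_pos r) (nome_lt_one hr) h1).comp (analyticAt_cdArg r u)
  have a2 : AnalyticAt ℂ (fun u => cdHalf (nome r) (-cdArg r u)) u :=
    AnalyticAt.comp (f := fun u => -cdArg r u)
      (analyticAt_cdHalf (nome_pos r) (nome_lt_one hr) h2) (analyticAt_cdArg r u).neg
  exact analyticAt_const.mul ((a1.add a2).div analyticAt_const two_ne_zero)

theorem cdArg_re (r : ℝ) (u : ℂ) :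
    (cdArg r u).re = -(Real.pi / (2 * quarterK r) * u.im) := by
  have : cdArg r u = ((Real.pi / (2 * quarterK r) : ℝ) : ℂ) * (Complex.I * u) := by
    rw [cdArg]
    push_cast
    ring
  rw [this, Complex.re_ofReal_mul]
  simp

/-- Since `Re (cdArg r u) = -π Im u / (2K)` and `K' = K√r`, the strip is exactly where both
exponential series have ratio below `1`. -/
theorem nome_mul_exp_lt_one {r : ℝ} (hr : 0 < r) {u : ℂ} (hu : |u.im| < quarterK' r) :
    nome r * Real.exp (2 * (cdArg r u).re) < 1 ∧
      nome r * Real.exp (2 * (-cdArg r u).re) < 1 := by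
  have hK := quarterK_pos hr
  have hp := Real.pi_pos
  rw [quarterK'_eq hr] at hu
  obtain ⟨h1, h2⟩ := abs_lt.mp hu
  have key : ∀ y : ℝ, y < quarterK r * Real.sqrt r → Real.pi / quarterK r * y < Real.pi * Real.sqrt r := by
    intro y hy
    rw [div_mul_eq_mul_div, div_lt_iff₀ hK]
    nlinarith
  have e : Real.pi / (2 * quarterK r) = Real.pi / quarterK r / 2 := by
    field_simp
  rw [Complex.neg_re, cdArg_re, nome, ← Real.exp_add, ← Real.exp_add, Real.exp_lt_one_iff,
    Real.exp_lt_one_iff, e]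
  have k1 := key u.im h2
  have k2 := key (-u.im) (by linarith)
  constructor <;> linarith

theorem cdOneTerm_eq (r : ℝ) (u : ℂ) (n : ℕ) :
    cdOneTerm r u n =
      ((-1 : ℂ) ^ n * ((nome r ^ ((n : ℝ) + 1 / 2) : ℝ) : ℂ) * Complex.exp (cdArg r u) ^ (2 * n + 3)
          / (1 - (nome r : ℂ) ^ (2 * n + 1)) +
        (-1 : ℂ) ^ n * ((nome r ^ ((n : ℝ) + 1 / 2) : ℝ) : ℂ)
          * Complex.exp (-cdArg r u) ^ (2 * n + 3) / (1 - (nome r : ℂ) ^ (2 * n + 1))) / 2 := by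
  have h : Complex.cos ((2 * (n : ℂ) + 3) * ((Real.pi : ℂ) / (2 * (quarterK r : ℂ))) * u) =
      (Complex.exp (cdArg r u) ^ (2 * n + 3) + Complex.exp (-cdArg r u) ^ (2 * n + 3)) / 2 := by
    rw [Complex.cos, ← Complex.exp_nat_mul, ← Complex.exp_nat_mul, cdArg]
    push_cast
    congr 3 <;> ring_nf
  rw [cdOneTerm, h]
  ring

theorem isCdOne_toMeromorphicNFOn {r : ℝ} (hr : 0 < r) :
    IsCdOne r (toMeromorphicNFOn (cdOneSum r) Set.univ) := by
  refine ⟨meromorphicNFOn_toMeromorphicNFOn _ _, fun u hu => ?_⟩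
  have hq := nome_pos r
  have hq1 := nome_lt_one hr
  obtain ⟨l1, l2⟩ := nome_mul_exp_lt_one hr hu
  have han := analyticAt_cdOneSum hr (one_add_ne_zero_of_lt hq hq1 l1)
    (one_add_ne_zero_of_lt hq hq1 l2)
  rw [(toMeromorphicNFOn_eventuallyEq_of_analyticAt (meromorphicOn_cdOneSum hr) han).eq_of_nhds]
  simp only [cdOneTerm_eq]
  exact (((hasSum_cdHalf hq hq1 l1).add (hasSum_cdHalf hq hq1 l2)).div_const 2).mul_left _

theorem IsCdOne.unique {r : ℝ} (hr : 0 < r) {f g : ℂ → ℂ} (hf : IsCdOne r f) (hg : IsCdOne r g) :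
    f = g := by
  apply hf.1.eq_of_eventuallyEq hg.1 (z₀ := 0)
  have hopen : IsOpen {u : ℂ | |u.im| < quarterK' r} := isOpen_lt (by fun_prop) continuous_const
  have h0 : (0 : ℂ) ∈ {u : ℂ | |u.im| < quarterK' r} := by
    have := mul_pos (quarterK_pos hr) (Real.sqrt_pos.mpr hr)
    rw [← quarterK'_eq hr] at this
    simpa using this
  exact Filter.eventually_of_mem (hopen.mem_nhds h0) fun u hu => (hf.2 u hu).unique (hg.2 u hu)

theorem isCdOne_cdOne {r : ℝ} (hr : 0 < r) : IsCdOne r (cdOne r) :=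
  Classical.epsilon_spec ⟨_, isCdOne_toMeromorphicNFOn hr⟩

theorem cdOne_eventuallyEq {r : ℝ} (hr : 0 < r) {u : ℂ} (hu : AnalyticAt ℂ (cdOneSum r) u) :
    cdOne r =ᶠ[𝓝 u] cdOneSum r := by
  rw [(isCdOne_cdOne hr).unique hr (isCdOne_toMeromorphicNFOn hr)]
  exact toMeromorphicNFOn_eventuallyEq_of_analyticAt (meromorphicOn_cdOneSum hr) hu

/-! ### Evaluation at `mK + ν₁ iK'`. -/

theorem nome_pow (r : ℝ) (n : ℕ) : nome r ^ n = Real.exp (-(n * Real.pi * Real.sqrt r)) := by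
  rw [nome, ← Real.exp_nat_mul]
  congr 1
  ring

theorem exp_cdArg {r : ℝ} (hr : 0 < r) (N : ℕ) (l : ℤ) :
    Complex.exp (cdArg r (((l + l : ℤ) : ℂ) * quarterK r + ((2 * N : ℝ) : ℂ) * Complex.I * quarterK' r))
      = (((-1 : ℝ) ^ l * nome r ^ N : ℝ) : ℂ) := by
  have hK : (quarterK r : ℂ) ≠ 0 := by exact_mod_cast (quarterK_pos hr).ne'
  have h : cdArg r (((l + l : ℤ) : ℂ) * quarterK r + ((2 * N : ℝ) : ℂ) * Complex.I * quarterK' r) =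
      (l : ℂ) * (Real.pi * Complex.I) + ((-(N * Real.pi * Real.sqrt r) : ℝ) : ℂ) := by
    rw [cdArg, quarterK'_eq hr]
    push_cast
    field_simp
    linear_combination (2 * (N : ℂ) * Real.sqrt r) * Complex.I_sq
  rw [h, Complex.exp_add, Complex.exp_int_mul, Complex.exp_pi_mul_I, ← Complex.ofReal_exp,
    ← nome_pow]
  push_cast
  rfl

theorem theorem15 (r : ℝ) (hr : 0 < r) (ν ν₁ : ℝ) (N : ℕ) (hN : 0 < N) (hν : 1 / ν = (N : ℝ))
    (hν₁ : ν₁ = 2 / ν) (m : ℤ) (hm : Even m) :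
    IsCdOne r (cdOne r) ∧
    AnalyticAt ℂ (cdOne r)
      ((m : ℂ) * (quarterK r : ℂ) + (ν₁ : ℂ) * Complex.I * (quarterK' r : ℂ)) ∧
    cdOne r ((m : ℂ) * (quarterK r : ℂ) + (ν₁ : ℂ) * Complex.I * (quarterK' r : ℂ)) =
      (((-1 : ℝ) ^ (m / 2) * Real.exp (ν₁ * Real.pi * Real.sqrt r)
        - (-1 : ℝ) ^ (m / 2) * (2 * Real.pi / (quarterK r * singularModulus r))
          * Real.sinh (ν₁ * Real.pi * Real.sqrt r)
          * (-(∑ j ∈ Finset.range N,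
                nome r ^ ((j : ℝ) + 1 / 2) / (1 + nome r ^ (2 * j + 1)))
              + quarterK r * singularModulus r / (2 * Real.pi)) : ℝ) : ℂ) := by
  obtain ⟨l, rfl⟩ := hm
  have hν₁' : ν₁ = 2 * N := by rw [hν₁, ← hν]; ring
  subst hν₁'
  rw [show (l + l) / 2 = l by omega]
  have hq := nome_pos r
  have hε : ((-1 : ℝ) ^ l) ^ 2 = 1 := by
    rw [← zpow_natCast, ← zpow_mul, mul_comm, zpow_mul]
    norm_num
  have e1 := exp_cdArg hr N l
  generalize (-1 : ℝ) ^ l = ε at hε e1 ⊢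
  have hεinv : ε⁻¹ = ε := inv_eq_of_mul_eq_one_left (by rw [← sq, hε])
  set u : ℂ := ((l + l : ℤ) : ℂ) * quarterK r + ((2 * N : ℝ) : ℂ) * Complex.I * quarterK' r with hu
  have e2 : Complex.exp (-cdArg r u) = ((ε * (nome r ^ N)⁻¹ : ℝ) : ℂ) := by
    rw [Complex.exp_neg, e1, ← Complex.ofReal_inv, mul_inv, hεinv]
  -- Both exponentials are real and nonzero, so their squares are positive and no denominator `1 +
  -- q^{2k+1} x²` vanishes.
  have han : AnalyticAt ℂ (cdOneSum r) u := by
    refine analyticAt_cdOneSum hr (fun k => ?_) (fun k => ?_)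
    · rw [e1]
      norm_cast
      rw [mul_pow, hε]
      positivity
    · rw [e2]
      norm_cast
      rw [mul_pow, hε]
      positivity
  have hev := cdOne_eventuallyEq hr han
  refine ⟨isCdOne_cdOne hr, han.congr hev.symm, ?_⟩
  have hS := hasSum_lambert hr
  rw [hev.eq_of_nhds, cdOneSum, cdHalf_of_exp_eq_pow hq hε N e1 hS,
    cdHalf_of_exp_eq_inv_pow hq hε N e2 hS]
  set P := ∑ j ∈ Finset.range N, nome r ^ ((j : ℝ) + 1 / 2) / (1 + nome r ^ (2 * j + 1))
  have hQ : nome r ^ (2 * N) = Real.exp (-(2 * N * Real.pi * Real.sqrt r)) := by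
    rw [nome_pow]
    push_cast
    rfl
  rw [hQ, ← Real.exp_neg, neg_neg]
  have hk : 0 < singularModulus r := by
    rw [singularModulus_eq hr]
    exact (isSingularModulus_sechReal hr).1
  have hcS : 2 * Real.pi / (quarterK r * singularModulus r) *
      (quarterK r * singularModulus r / (2 * Real.pi)) = 1 := by
    have := quarterK_pos hr
    have := Real.pi_pos
    field_simp
  have hc : 2 * (Real.pi : ℂ) / ((quarterK r : ℂ) * (singularModulus r : ℂ)) =
      ((2 * Real.pi / (quarterK r * singularModulus r) : ℝ) : ℂ) := by
    push_cast
    rfl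
  rw [hc]
  generalize 2 * Real.pi / (quarterK r * singularModulus r) = c at hcS
  generalize quarterK r * singularModulus r / (2 * Real.pi) = S at hcS
  rw [Real.sinh_eq]
  generalize Real.exp (2 * N * Real.pi * Real.sqrt r) = E
  generalize Real.exp (-(2 * N * Real.pi * Real.sqrt r)) = E'
  norm_cast
  -- The left side is `(cε/2)(E'(S - P) + E(S + P))`, that is `cεES - cε((E - E')/2)(S - P)`, and
  -- `cS = 1`.
  linear_combination (ε * E) * hcS
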